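/- **Setting.** Write $[i:j]=\{i,\dots,j\}$ (empty if $i>j$). An $(N,K)$ PIR code with message length $L\ge 1$ over a finite alphabet $\mathcal X$ with $|\mathcal X|\ge 2$ consists of the following. The messages $W_1,\dots,W_K$ are independent and uniform on $\mathcal X^L$. Server $n\in[1:N]$ stores $S_n\in\mathcal S_n$ ($\mathcal S_n$ finite), a function of $W_{1:K}$. A discrete random key $\mathbf F$ is independent of $W_{1:K}$, and the queries $Q^{[k]}_{1:N}$ for message $k$ are functions of $\mathbf F$. The answer $A_n^{[k]}\in\mathcal Y^{\ell_n}$ ($\mathcal Y$ finite) of server $n$ is a function of $(Q_n^{[k]},S_n)$ that does not depend on $k$, and its length $\ell_n$ is a function of the query $Q_n^{[k]}$. The message $W_k$ is determined by $A_{1:N}^{[k]}$ and $Q_{1:N}^{[k]}$, and for each $n$ the distribution of $Q_n^{[k]}$ is the same for all $k\in[1:K]$. The costs of the code are $$\bar\alpha=\frac1{NL}\sum_{n=1}^N\log_{|\mathcal X|}|\mathcal S_n|,\qquad \bar\beta=\frac{\log_{|\mathcal X|}|\mathcal Y|}{NL}\sum_{n=1}^N\mathbb E(\ell_n).$$ A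 pair $(\alpha,\beta)$ of real numbers is achievable if some $(N,K)$ PIR code has $\bar\alpha\le\alpha$ and $\bar\beta\le\beta$. Put $$B_N(K,m)=\inf_{(\alpha,\beta)\text{ achievable}}\{(N-m)\alpha+m\beta\}.$$ **The explicit bound.** Let $\beta_0=\beta_0(N,K)=\sum_{i=1}^K N^{-i}$. Define $\underline{\underline{B_N}}(K,m)$ for $m\in[1:N]$ by the boundary values $\underline{\underline{B_N}}(1,m)=1$ and, for $K\ge 2$, $\underline{\underline{B_N}}(K,1)=K$, $\underline{\underline{B_N}}(K,N)=N\beta_0$, and, for $m\in[2:N-1]$, as follows. * If $K=2$, let $j^*=\max\left\{2,\left\lceil N+\tfrac12-\sqrt{(N-m)(N+m-1)+\tfrac14}\right\rceil\right\}$ and $$\underline{\underline{B_N}}(2,m)=1+\frac{m-j^*+1}{N}+\sum_{j=j^*}^{m-1}\frac{(m-j)(m+j-1)}{2j(j-1)N}+\frac{N-j^*}{N-j^*+1}\left(1-\frac1{N-j^*}\cdot\frac{(m-j^*)(m+j^*-1)}{2(j^*-1)}\right).$$ * If $K\ge 3$, let $j^*$ be the least $j\in[2:m]$ with $\sum_{i=j+1}^m\frac{N-i+1}{i-1}\le\frac{(m-1)(N-m)}{m}$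 and $$\underline{\underline{B_N}}(K,m)=1+\sum_{j=j^*}^m\frac1j\,\underline{\underline{B_N}}(K-1,j)+\frac1{N-j^*+1}\left[\frac{(N-m)(m-1)}{m}-\sum_{i=j^*+1}^m\frac{N-i+1}{i-1}\right]\underline{\underline{B_N}}(K-1,j^*-1).$$ **Theorem.** For all integers $K\ge 2$, $N\ge 2$ and $m\in[1:N]$, $$B_N(K,m)\ \ge\ \underline{\underline{B_N}}(K,m).$$ -/

import Mathlib

open scoped ENNReal BigOperators

namespace PIR

/-- An `(N, K)` private information retrieval code with message length `L`, message alphabet `X`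
and answer alphabet `Y`.

The messages `W_1, …, W_K` are independent and uniform on `X ^ L`, and the random key `F` is
independent of them; the underlying probability space is thus the product of the uniform
distribution on `Fin K → Fin L → X` and the law `key` of `F`. Every relation `H(U | V) = 0` is
expressed by a function computing `U` from `V`. Since the uniform law charges every `w`, only the
null set of the key has to be left out, in the decodability condition. -/
structure PIRCode (N K L : ℕ) (X Y : Type) where
  /-- The alphabet of the content stored at each server. -/
  Store : Fin N → Type
  [storeFintype : ∀ n, Fintype (Store n)]
  /-- The alphabet of the random key. -/
  Key : Type
  /-- The law of the random key (an arbitrary discrete distribution). -/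
  key : PMF Key
  /-- The query alphabet of each server. -/
  Query : Fin N → Type
  /-- `S_n` as a function of the messages `W_{1:K}`. -/
  store : ∀ n, (Fin K → Fin L → X) → Store n
  /-- `Q_{1:N}^{[k]}` as a function of the random key. -/
  query : Fin K → Key → ∀ n, Query n
  /-- The length `ℓ_n` of the answer to a given query. -/
  len : ∀ n, Query n → ℕ
  /-- The answer of server `n`, a function of the received query and of the stored content only. -/
  answer : ∀ n (q : Query n), Store n → (Fin (len n q) → Y)
  /-- Reconstruction of `W_k` from the queries and the answers. -/
  decode : ∀ (_ : Fin K) (q : ∀ n, Query n), (∀ n, Fin (len n (q n)) → Y) → (Fin L → X)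
  /-- Decodability: `W_k` is recovered without error. -/
  decode_eq : ∀ (k : Fin K), ∀ f ∈ key.support, ∀ w : Fin K → Fin L → X,
    decode k (query k f) (fun n => answer n (query k f n) (store n w)) = w k
  /-- Privacy: the law of `Q_n^{[k]}` does not depend on `k`. -/
  privacy : ∀ (n : Fin N) (k k' : Fin K),
    key.map (fun f => query k f n) = key.map (fun f => query k' f n)

attribute [instance] PIRCode.storeFintype

/-- The operational normalized average storage cost
`(1 / (N L)) ∑ₙ log_{|X|} |𝒮ₙ|`. -/
noncomputable def PIRCode.storageCost {N K L : ℕ} {X Y : Type} [Fintype X]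
    (c : PIRCode N K L X Y) : ℝ :=
  1 / ((N : ℝ) * (L : ℝ)) *
    ∑ n : Fin N, Real.logb (Fintype.card X : ℝ) (Fintype.card (c.Store n) : ℝ)

/-- The expected length `𝔼 ℓ_n` of the answer of server `n` when message `k` is retrieved. -/
noncomputable def PIRCode.expectedLen {N K L : ℕ} {X Y : Type}
    (c : PIRCode N K L X Y) (k : Fin K) (n : Fin N) : ℝ≥0∞ :=
  ∑' f : c.Key, c.key f * (c.len n (c.query k f n) : ℝ≥0∞)

/-- The operational normalized average download cost
`(log_{|X|} |𝒴| / (N L)) ∑ₙ 𝔼 ℓₙ` when message `k` is retrieved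
(by privacy it does not depend on `k`). -/
noncomputable def PIRCode.downloadCost {N K L : ℕ} {X Y : Type} [Fintype X] [Fintype Y]
    (c : PIRCode N K L X Y) (k : Fin K) : ℝ≥0∞ :=
  ENNReal.ofReal
      (Real.logb (Fintype.card X : ℝ) (Fintype.card Y : ℝ) / ((N : ℝ) * (L : ℝ))) *
    ∑ n : Fin N, c.expectedLen k n

/-- The pair `(α, β)` is achievable by some `(N, K)` PIR code, over some finite alphabets `X`
(with at least two symbols) and `Y`, and for some message length `L ≥ 1`. -/
def Achievable (N K : ℕ) (α β : ℝ) : Prop :=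
  ∃ (L : ℕ) (X Y : Type) (_ : Fintype X) (_ : Fintype Y) (c : PIRCode N K L X Y),
    1 ≤ L ∧ 2 ≤ Fintype.card X ∧ c.storageCost ≤ α ∧
      ∀ k : Fin K, ((c.downloadCost k : ℝ≥0∞) : EReal) ≤ ((β : ℝ) : EReal)

/-- `B_N(K, m)`, the infimum of `(N - m) α + m β` over all achievable pairs `(α, β)`. -/
noncomputable def optB (N K m : ℕ) : ℝ :=
  sInf {x : ℝ | ∃ α β : ℝ, Achievable N K α β ∧ x = ((N : ℝ) - (m : ℝ)) * α + (m : ℝ) * β}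

/-- `β₀ = 1/N + 1/N² + ⋯ + 1/N^K`. -/
noncomputable def beta0 (N K : ℕ) : ℝ :=
  ∑ i ∈ Finset.Icc 1 K, 1 / (N : ℝ) ^ i

/-- The threshold index `j*` for `K = 2`. -/
noncomputable def jStarTwo (N m : ℕ) : ℕ :=
  max 2 ⌈((N : ℝ) + 1 / 2) -
    Real.sqrt (((N : ℝ) - (m : ℝ)) * ((N : ℝ) + (m : ℝ) - 1) + 1 / 4)⌉₊

/-- The threshold index `j*` for `K ≥ 3`: the least `j ∈ [2 : m]` satisfying the inequality
(for `m ≥ 2` it exists, since `j = m` makes the sum empty). -/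
noncomputable def jStar (N m : ℕ) : ℕ :=
  sInf {j : ℕ | 2 ≤ j ∧ j ≤ m ∧
    ∑ i ∈ Finset.Icc (j + 1) m, ((N : ℝ) - (i : ℝ) + 1) / ((i : ℝ) - 1) ≤
      ((m : ℝ) - 1) * ((N : ℝ) - (m : ℝ)) / (m : ℝ)}

/-- The closed form for `K = 2` and `2 ≤ m ≤ N - 1`, as a function of `j*`. -/
noncomputable def formulaTwo (N m js : ℕ) : ℝ :=
  1 + ((m : ℝ) - (js : ℝ) + 1) / (N : ℝ)
    + ∑ j ∈ Finset.Icc js (m - 1),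
        (((m : ℝ) - (j : ℝ)) * ((m : ℝ) + (j : ℝ) - 1)) /
          (2 * (j : ℝ) * ((j : ℝ) - 1) * (N : ℝ))
    + ((N : ℝ) - (js : ℝ)) / ((N : ℝ) - (js : ℝ) + 1) *
        (1 - 1 / ((N : ℝ) - (js : ℝ)) *
          ((((m : ℝ) - (js : ℝ)) * ((m : ℝ) + (js : ℝ) - 1)) / (2 * ((js : ℝ) - 1))))

/-- The recursion step for `K ≥ 3` and `2 ≤ m ≤ N - 1`, as a function of `j*` and of the values
`prev j` of the bound for `K - 1` messages. -/
noncomputable def formulaStep (N m js : ℕ) (prev : ℕ → ℝ) : ℝ :=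
  1 + ∑ j ∈ Finset.Icc js m, 1 / (j : ℝ) * prev j
    + 1 / ((N : ℝ) - (js : ℝ) + 1) *
        (((N : ℝ) - (m : ℝ)) * ((m : ℝ) - 1) / (m : ℝ)
          - ∑ i ∈ Finset.Icc (js + 1) m, ((N : ℝ) - (i : ℝ) + 1) / ((i : ℝ) - 1)) *
        prev (js - 1)

/-- The explicit bound, defined by recursion on the number of messages (the value at `K = 0` is
never used). -/
noncomputable def explicitB (N : ℕ) : ℕ → ℕ → ℝ
  | 0, _ => 0
  | 1, _ => 1
  | 2, m =>
      if m = 1 then 2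
      else if m = N then (N : ℝ) * beta0 N 2
      else formulaTwo N m (jStarTwo N m)
  | K + 3, m =>
      if m = 1 then ((K + 3 : ℕ) : ℝ)
      else if m = N then (N : ℝ) * beta0 N (K + 3)
      else formulaStep N m (jStar N m) (explicitB N (K + 2))

end PIR

/-! Let `l` be the entropy of one message and `h_r(m)` the entropy, averaged over servers and
queries, of the answers of `m` servers for message `r` and the contents of the other `N - m`, given
the messages before `r`. For the first message, subadditivity bounds `h_r(m)` above by `l * ((N - m)
α + m β)`. It remains to bound it below by `l * explicitB`, by induction on the number of unknown
messages.

Contents determine answers, so message `r` is decodable and contributes `l`. Given the messages up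
to `r`, let `σ j` be the average entropy of `N - j` contents and `a j` that of one further answer
given those contents. The chain rule gives `h_r(m) ≥ l + σ m + ∑_{j ≤ m} a j`
(`PIRCode.le_avgEntropy`) and `h_{r+1}(j) ≤ σ j + j * a j` (`PIRCode.avgEntropy_le`). Each `a j`
involves a single answer, so privacy makes it the same for messages `r` and `r + 1`.

What remains is linear programming in `σ` and `a`. For three or more messages, Han's inequality for
the contents suffices (`formulaStep_le`). For two, only one unknown message is left, and `σ j ≤ l`
together with an interpolation between answers and contents
(`PIRCode.le_mul_avgStore_add_avgAnswer`) sharpens the bound (`formulaTwo_le`). In both cases `j*`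
marks where the optimal dual weights change form. -/

namespace PIR

/-! ### Entropy of partitions of a finite uniform space. -/

section Entropy

variable {Ω : Type*} [Fintype Ω]

open Classical in
/-- The size of the class of `x`, as a real number. -/
noncomputable def classSize (r : Setoid Ω) (x : Ω) : ℝ :=
  ((Finset.univ.filter fun y => r x y).card : ℝ)

/-- The Shannon entropy of the partition into the classes of `r`, for the uniform law on `Ω`. -/
noncomputable def entropy (r : Setoid Ω) : ℝ :=
  Real.log (Fintype.card Ω) - (∑ x, Real.log (classSize r x)) / Fintype.card Ω

theorem classSize_pos (r : Setoid Ω) (x : Ω) : 0 < classSize r x := by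
  classical
  unfold classSize
  exact_mod_cast Finset.card_pos.2 ⟨x, by simp⟩

theorem classSize_mono {r s : Setoid Ω} (h : r ≤ s) (x : Ω) : classSize r x ≤ classSize s x := by
  classical
  unfold classSize
  exact_mod_cast Finset.card_le_card
    (Finset.monotone_filter_right _ fun y _ hy => h hy)

theorem classSize_congr (r : Setoid Ω) {x y : Ω} (h : r x y) : classSize r x = classSize r y := by
  classical
  unfold classSize
  congr 2
  ext z
  simp only [Finset.mem_filter, Finset.mem_univ, true_and]
  exact ⟨fun hz => r.trans (r.symm h) hz, fun hz => r.trans h hz⟩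

theorem classSize_eq_sum (r : Setoid Ω) (x : Ω) :
    classSize r x = ∑ y, open Classical in if r x y then (1 : ℝ) else 0 := by
  classical
  unfold classSize
  rw [Finset.sum_boole]

/-- In the order on `Setoid`, smaller means finer, so `⊓` plays the role of the joint variable. -/
theorem entropy_antitone : Antitone (entropy : Setoid Ω → ℝ) := by
  intro r s h
  unfold entropy
  gcongr with x
  · exact classSize_pos r x
  · exact classSize_mono h x

/-- Expand the numerator as a count of pairs `(y, z)`. For a fixed pair, the admissible `x` form
either the empty set or one class of `r ⊓ s ⊓ t`, so they contribute at most the reciprocal of the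
`t`-class of `y`, and only if `y` and `z` are `t`-equivalent. -/
theorem sum_classSize_ratio_le (r s t : Setoid Ω) :
    ∑ x, classSize (r ⊓ t) x * classSize (s ⊓ t) x /
      (classSize (r ⊓ s ⊓ t) x * classSize t x) ≤ Fintype.card Ω := by
  classical
  have expand : ∀ x, classSize (r ⊓ t) x * classSize (s ⊓ t) x /
      (classSize (r ⊓ s ⊓ t) x * classSize t x) =
      ∑ y, ∑ z, if (r ⊓ t) x y ∧ (s ⊓ t) x z then
        1 / (classSize (r ⊓ s ⊓ t) x * classSize t x) else 0 := by
    intro x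
    rw [classSize_eq_sum (r ⊓ t), classSize_eq_sum (s ⊓ t), Finset.sum_mul_sum, Finset.sum_div]
    refine Finset.sum_congr rfl fun y _ => ?_
    rw [Finset.sum_div]
    refine Finset.sum_congr rfl fun z _ => ?_
    by_cases h1 : (r ⊓ t) x y <;> by_cases h2 : (s ⊓ t) x z <;> simp [h1, h2]
  have inner : ∀ y z, (∑ x, if (r ⊓ t) x y ∧ (s ⊓ t) x z then
      1 / (classSize (r ⊓ s ⊓ t) x * classSize t x) else 0) ≤
      if t y z then 1 / classSize t y else 0 := by
    intro y z
    by_cases hne : ∃ x, (r ⊓ t) x y ∧ (s ⊓ t) x z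
    · obtain ⟨x₀, h1, h2⟩ := hne
      have htyz : t y z := t.trans (t.symm h1.2) h2.2
      rw [if_pos htyz]
      have : ∀ x, (if (r ⊓ t) x y ∧ (s ⊓ t) x z then
          1 / (classSize (r ⊓ s ⊓ t) x * classSize t x) else 0) =
          (if (r ⊓ s ⊓ t) x₀ x then (1 : ℝ) else 0) *
            (1 / (classSize (r ⊓ s ⊓ t) x₀ * classSize t y)) := by
        intro x
        by_cases hx : (r ⊓ s ⊓ t) x₀ x
        · have hx' : (r ⊓ t) x y ∧ (s ⊓ t) x z :=
            ⟨⟨r.trans (r.symm hx.1.1) h1.1, t.trans (t.symm hx.2) h1.2⟩,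
              ⟨s.trans (s.symm hx.1.2) h2.1, t.trans (t.symm hx.2) h2.2⟩⟩
          rw [if_pos hx', if_pos hx, classSize_congr _ hx, classSize_congr t hx'.1.2, one_mul]
        · have hx' : ¬ ((r ⊓ t) x y ∧ (s ⊓ t) x z) := fun h => hx
            ⟨⟨r.trans h1.1 (r.symm h.1.1), s.trans h2.1 (s.symm h.2.1)⟩,
              t.trans h1.2 (t.symm h.1.2)⟩
          rw [if_neg hx', if_neg hx, zero_mul]
      rw [Finset.sum_congr rfl fun x _ => this x, ← Finset.sum_mul, ← classSize_eq_sum]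
      have h3 := (classSize_pos (r ⊓ s ⊓ t) x₀).ne'
      have h4 := (classSize_pos t y).ne'
      apply le_of_eq
      field_simp
    · push Not at hne
      rw [Finset.sum_eq_zero fun x _ => if_neg fun h => hne x h.1 h.2]
      have := classSize_pos t y
      split_ifs <;> positivity
  calc _ = ∑ y, ∑ z, ∑ x, (if (r ⊓ t) x y ∧ (s ⊓ t) x z then
        1 / (classSize (r ⊓ s ⊓ t) x * classSize t x) else 0) := by
        rw [Finset.sum_congr rfl fun x _ => expand x, Finset.sum_comm]
        exact Finset.sum_congr rfl fun y _ => Finset.sum_comm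
    _ ≤ ∑ y, ∑ z, if t y z then 1 / classSize t y else 0 :=
        Finset.sum_le_sum fun y _ => Finset.sum_le_sum fun z _ => inner y z
    _ = ∑ y : Ω, (1 : ℝ) := by
        refine Finset.sum_congr rfl fun y _ => ?_
        have h4 := (classSize_pos t y).ne'
        have : ∀ z, (if t y z then 1 / classSize t y else 0) =
            (if t y z then (1 : ℝ) else 0) * (1 / classSize t y) := by
          intro z; split_ifs <;> simp
        rw [Finset.sum_congr rfl fun z _ => this z, ← Finset.sum_mul, ← classSize_eq_sum]
        field_simp
    _ = Fintype.card Ω := by simp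

/-- Nonnegativity of conditional mutual information: apply `log u ≤ u - 1` to the ratios of
`sum_classSize_ratio_le`. -/
theorem entropy_submodular (r s t : Setoid Ω) :
    entropy (r ⊓ s ⊓ t) + entropy t ≤ entropy (r ⊓ t) + entropy (s ⊓ t) := by
  have key : ∑ x, (Real.log (classSize (r ⊓ t) x) + Real.log (classSize (s ⊓ t) x)
      - Real.log (classSize (r ⊓ s ⊓ t) x) - Real.log (classSize t x)) ≤ 0 := by
    calc _ ≤ ∑ x, (classSize (r ⊓ t) x * classSize (s ⊓ t) x /
          (classSize (r ⊓ s ⊓ t) x * classSize t x) - 1) := by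
          refine Finset.sum_le_sum fun x _ => ?_
          have h1 := classSize_pos (r ⊓ t) x
          have h2 := classSize_pos (s ⊓ t) x
          have h3 := classSize_pos (r ⊓ s ⊓ t) x
          have h4 := classSize_pos t x
          have h := Real.log_le_sub_one_of_pos
            (div_pos (mul_pos h1 h2) (mul_pos h3 h4))
          rw [Real.log_div (by positivity) (by positivity), Real.log_mul h1.ne' h2.ne',
            Real.log_mul h3.ne' h4.ne'] at h
          linarith
      _ ≤ 0 := by
          rw [Finset.sum_sub_distrib]
          have := sum_classSize_ratio_le r s t
          simp only [Finset.sum_const, Finset.card_univ, nsmul_eq_mul, mul_one]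
          linarith
  rw [Finset.sum_sub_distrib, Finset.sum_sub_distrib, Finset.sum_add_distrib] at key
  have h := div_nonpos_of_nonpos_of_nonneg key (Nat.cast_nonneg (α := ℝ) (Fintype.card Ω))
  rw [sub_div, sub_div, add_div] at h
  unfold entropy
  linarith

theorem entropy_ker_le_log_card [Nonempty Ω] {α : Type*} [Fintype α] (f : Ω → α) :
    entropy (Setoid.ker f) ≤ Real.log (Fintype.card α) := by
  classical
  have hΩ : (0 : ℝ) < Fintype.card Ω := by exact_mod_cast Fintype.card_pos
  have hα : (0 : ℝ) < Fintype.card α := by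
    have : Nonempty α := ⟨f (Classical.arbitrary Ω)⟩
    exact_mod_cast Fintype.card_pos
  -- The left side counts the nonempty fibres of `f`.
  have hsum : ∑ x, 1 / classSize (Setoid.ker f) x ≤ Fintype.card α := by
    rw [← Finset.sum_fiberwise (s := Finset.univ) (g := f)]
    calc _ ≤ ∑ _a : α, (1 : ℝ) := by
          refine Finset.sum_le_sum fun a _ => ?_
          by_cases hne : ∃ x₀, f x₀ = a
          · obtain ⟨x₀, rfl⟩ := hne
            have : ∀ x ∈ Finset.univ.filter (fun x => f x = f x₀),
                1 / classSize (Setoid.ker f) x = 1 / classSize (Setoid.ker f) x₀ := by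
              intro x hx
              rw [classSize_congr (Setoid.ker f) (x := x) (y := x₀)]
              simpa [Setoid.ker_def] using hx
            rw [Finset.sum_congr rfl this, Finset.sum_const, nsmul_eq_mul]
            have h2 : ((Finset.univ.filter (fun x => f x = f x₀)).card : ℝ) =
                classSize (Setoid.ker f) x₀ := by
              unfold classSize
              congr 2
              ext x
              simp [Setoid.ker_def, eq_comm]
            rw [h2, mul_one_div_cancel (classSize_pos _ _).ne']
          · push Not at hne
            rw [Finset.filter_false_of_mem fun x _ => hne x]
            simp
      _ = Fintype.card α := by simp
  have key : ∑ x, (Real.log (Fintype.card Ω) - Real.log (classSize (Setoid.ker f) x)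
      - Real.log (Fintype.card α)) ≤ 0 := by
    calc _ ≤ ∑ x, ((Fintype.card Ω : ℝ) / Fintype.card α * (1 / classSize (Setoid.ker f) x) - 1) := by
          refine Finset.sum_le_sum fun x _ => ?_
          have h3 := classSize_pos (Setoid.ker f) x
          have h := Real.log_le_sub_one_of_pos
            (mul_pos (div_pos hΩ hα) (one_div_pos.2 h3))
          rw [Real.log_mul (by positivity) (by positivity), Real.log_div hΩ.ne' hα.ne',
            one_div, Real.log_inv] at h
          rw [one_div]
          linarith
      _ ≤ 0 := by
          rw [Finset.sum_sub_distrib, ← Finset.mul_sum]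
          have h1 : (Fintype.card Ω : ℝ) / Fintype.card α * ∑ x, 1 / classSize (Setoid.ker f) x
              ≤ (Fintype.card Ω : ℝ) / Fintype.card α * Fintype.card α := by gcongr
          rw [div_mul_cancel₀ _ hα.ne'] at h1
          simp only [Finset.sum_const, Finset.card_univ, nsmul_eq_mul, mul_one]
          linarith
  rw [Finset.sum_sub_distrib, Finset.sum_sub_distrib] at key
  simp only [Finset.sum_const, Finset.card_univ, nsmul_eq_mul] at key
  unfold entropy
  have h : (Fintype.card Ω : ℝ) * (Real.log (Fintype.card Ω) - (∑ x, Real.log (classSize (Setoid.ker f) x))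
      / Fintype.card Ω) ≤ Fintype.card Ω * Real.log (Fintype.card α) := by
    rw [mul_sub, mul_div_cancel₀ _ hΩ.ne']
    linarith
  exact le_of_mul_le_mul_left h hΩ

end Entropy

/-! ### Abstract submodular functions. -/

section Rank

variable {α : Type*} [SemilatticeInf α] [OrderTop α]

/-- A normalized, order-reversing, submodular function: the abstract properties of a (conditional)
entropy, with `r ⊓ s` in the role of the joint variable. -/
structure IsRank (φ : α → ℝ) : Prop where
  top : φ ⊤ = 0
  anti : Antitone φ
  sub : ∀ r s t, φ (r ⊓ s ⊓ t) + φ t ≤ φ (r ⊓ t) + φ (s ⊓ t)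

variable {φ : α → ℝ}

theorem IsRank.nonneg (hφ : IsRank φ) (r : α) : 0 ≤ φ r := hφ.top ▸ hφ.anti le_top

/-- Conditioning on more reduces the conditional rank. -/
theorem IsRank.cond_anti (hφ : IsRank φ) (r : α) {s t : α} (h : s ≤ t) :
    φ (r ⊓ s) - φ s ≤ φ (r ⊓ t) - φ t := by
  have := hφ.sub r s t
  rw [inf_assoc, inf_eq_left.2 h] at this
  linarith

theorem IsRank.cond_inf_le {ι : Type*} [DecidableEq ι] (hφ : IsRank φ) (I : Finset ι) (τ : ι → α)
    (t : α) : φ (I.inf τ ⊓ t) - φ t ≤ ∑ i ∈ I, (φ (τ i ⊓ t) - φ t) := by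
  induction I using Finset.induction_on with
  | empty => simp
  | insert i I hi ih =>
    rw [Finset.sum_insert hi, Finset.inf_insert]
    have := hφ.sub (τ i) (I.inf τ) t
    linarith

/-- Han's inequality for the subsets obtained by leaving out one element. -/
theorem IsRank.han_erase {ι : Type*} [DecidableEq ι] (hφ : IsRank φ) (σ : ι → α) (I : Finset ι)
    (hI : I.Nonempty) (t : α) :
    ((I.card : ℝ) - 1) * φ (I.inf σ ⊓ t) + φ t ≤ ∑ i ∈ I, φ ((I.erase i).inf σ ⊓ t) := by
  induction hI using Finset.Nonempty.cons_induction generalizing t with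
  | singleton i => simp
  | cons i I hi hI ih =>
    rw [Finset.cons_eq_insert, Finset.sum_insert hi, Finset.card_insert_of_notMem hi,
      Finset.erase_insert hi, Finset.inf_insert]
    have h1 : ∑ j ∈ I, φ (((insert i I).erase j).inf σ ⊓ t) =
        ∑ j ∈ I, φ ((I.erase j).inf σ ⊓ (σ i ⊓ t)) := by
      refine Finset.sum_congr rfl fun j hj => ?_
      have hij : i ≠ j := fun h => hi (h ▸ hj)
      rw [Finset.erase_insert_of_ne hij, Finset.inf_insert]
      congr 1
      ac_rfl
    -- The element `i` moves into the condition, which is why the induction runs over all `t`.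
    have h2 := ih (σ i ⊓ t)
    have h3 := hφ.sub (σ i) (I.inf σ) t
    have h4 : I.inf σ ⊓ (σ i ⊓ t) = σ i ⊓ I.inf σ ⊓ t := by ac_rfl
    rw [h4] at h2
    rw [h1]
    push_cast
    linarith

end Rank

/-! ### Averages over orderings of the servers, and Han-type inequalities. -/

section PermAvg

open Equiv

variable {N : ℕ}

/-- The average over all permutations of `Fin N`. -/
noncomputable def permAvg (F : Perm (Fin N) → ℝ) : ℝ := (∑ π, F π) / (N.factorial : ℝ)

theorem permAvg_mul_right (τ : Perm (Fin N)) (F : Perm (Fin N) → ℝ) :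
    permAvg (fun π => F (π * τ)) = permAvg F := by
  unfold permAvg
  congr 1
  exact Equiv.sum_comp (Equiv.mulRight τ) F

theorem permAvg_mono {F G : Perm (Fin N) → ℝ} (h : ∀ π, F π ≤ G π) : permAvg F ≤ permAvg G := by
  unfold permAvg
  gcongr with π
  exact h π

theorem permAvg_add (F G : Perm (Fin N) → ℝ) :
    permAvg (fun π => F π + G π) = permAvg F + permAvg G := by
  simp [permAvg, Finset.sum_add_distrib, add_div]

theorem permAvg_sub (F G : Perm (Fin N) → ℝ) :
    permAvg (fun π => F π - G π) = permAvg F - permAvg G := by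
  simp [permAvg, Finset.sum_sub_distrib, sub_div]

theorem permAvg_const_mul (c : ℝ) (F : Perm (Fin N) → ℝ) :
    permAvg (fun π => c * F π) = c * permAvg F := by
  simp [permAvg, ← Finset.mul_sum, mul_div_assoc]

theorem permAvg_sum {ι : Type*} (I : Finset ι) (F : ι → Perm (Fin N) → ℝ) :
    permAvg (fun π => ∑ i ∈ I, F i π) = ∑ i ∈ I, permAvg (F i) := by
  simp only [permAvg]
  rw [Finset.sum_comm, Finset.sum_div]

theorem permAvg_const (c : ℝ) : permAvg (fun _ : Perm (Fin N) => c) = c := by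
  have : (N.factorial : ℝ) ≠ 0 := by exact_mod_cast N.factorial_ne_zero
  simp [permAvg, Fintype.card_perm, this]

/-- A single server is uniformly distributed under a random permutation. -/
theorem permAvg_apply (i : Fin N) (g : Fin N → ℝ) :
    permAvg (fun π => g (π i)) = (∑ n, g n) / N := by
  have hN : (N : ℝ) ≠ 0 := by
    have := i.pos
    positivity
  have h1 : ∀ j, permAvg (fun π => g (π j)) = permAvg (fun π => g (π i)) := by
    intro j
    rw [← permAvg_mul_right (swap i j)]
    simp
  have h2 : ∑ j, permAvg (fun π => g (π j)) = ∑ n, g n := by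
    rw [← permAvg_sum]
    simp_rw [Equiv.sum_comp _ g]
    exact permAvg_const _
  simp_rw [h1] at h2
  simp only [Finset.sum_const, Finset.card_univ, Fintype.card_fin, nsmul_eq_mul] at h2
  rw [← h2, mul_div_cancel_left₀ _ hN]

/-- The positions `0, …, k - 1`. -/
def lower (N k : ℕ) : Finset (Fin N) := Finset.univ.filter fun i => (i : ℕ) < k

/-- The positions `k, …, N - 1`. -/
def upper (N k : ℕ) : Finset (Fin N) := Finset.univ.filter fun i => k ≤ (i : ℕ)

theorem mem_lower {k : ℕ} {i : Fin N} : i ∈ lower N k ↔ (i : ℕ) < k := by simp [lower]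

theorem mem_upper {k : ℕ} {i : Fin N} : i ∈ upper N k ↔ k ≤ (i : ℕ) := by simp [upper]

theorem lower_zero : lower N 0 = ∅ := by simp [lower]

theorem lower_succ {k : ℕ} (hk : k < N) : lower N (k + 1) = insert ⟨k, hk⟩ (lower N k) := by
  ext i
  simp only [mem_lower, Finset.mem_insert, Fin.ext_iff]
  omega

theorem notMem_lower_self {k : ℕ} (hk : k < N) : (⟨k, hk⟩ : Fin N) ∉ lower N k := by
  simp [mem_lower]

theorem card_lower {k : ℕ} (hk : k ≤ N) : (lower N k).card = k := by
  induction k with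
  | zero => simp [lower_zero]
  | succ k ih => rw [lower_succ hk, Finset.card_insert_of_notMem (notMem_lower_self hk), ih (Nat.le_of_succ_le hk)]

theorem upper_eq_insert {k : ℕ} (hk : k < N) : upper N k = insert ⟨k, hk⟩ (upper N (k + 1)) := by
  ext i
  simp only [mem_upper, Finset.mem_insert, Fin.ext_iff]
  omega

theorem upper_self : upper N N = ∅ := by
  ext i
  simp [mem_upper]

theorem card_upper {k : ℕ} (hk : k ≤ N) : (upper N k).card = N - k := by
  have h : upper N k = (lower N k)ᶜ := by
    ext i
    simp [mem_upper, mem_lower]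
  rw [h, Finset.card_compl, card_lower hk, Fintype.card_fin]

variable {α : Type*} [SemilatticeInf α] [OrderTop α]

/-- The average of the rank of `k` of the variables `σ`. -/
noncomputable def lowerAvg (φ : α → ℝ) (σ : Fin N → α) (k : ℕ) : ℝ :=
  permAvg fun π => φ ((lower N k).inf (σ ∘ π))

/-- The average conditional rank of one of the variables `τ` given `k` of the variables `σ` with
other indices. -/
noncomputable def condAvg (φ : α → ℝ) (σ τ : Fin N → α) (k : ℕ) : ℝ :=
  if hk : k < N then
    permAvg fun π => φ (τ (π ⟨k, hk⟩) ⊓ (lower N k).inf (σ ∘ π)) - φ ((lower N k).inf (σ ∘ π))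
  else 0

/-- The average rank of `k` of the variables `σ` together with the variables `τ` for all the other
indices. -/
noncomputable def mixedAvg (φ : α → ℝ) (σ τ : Fin N → α) (k : ℕ) : ℝ :=
  permAvg fun π => φ ((upper N k).inf (τ ∘ π) ⊓ (lower N k).inf (σ ∘ π))

variable {φ : α → ℝ} {σ τ : Fin N → α}

theorem lower_inf_comp_swap {i k : Fin N} (h : k ≤ i) (π : Perm (Fin N)) :
    (lower N k).inf (σ ∘ ⇑(π * swap k i)) = (lower N k).inf (σ ∘ π) := by
  refine Finset.inf_congr rfl fun x hx => ?_
  have hx' : x < k := mem_lower.1 hx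
  simp [swap_apply_of_ne_of_ne hx'.ne (hx'.trans_le h).ne]

/-- The transposition of `k` and `i` fixes all positions below `k`, so any position outside the
condition may stand for `k`. -/
theorem permAvg_cond_eq {i : Fin N} {k : ℕ} (h : k ≤ (i : ℕ)) :
    permAvg (fun π => φ (τ (π i) ⊓ (lower N k).inf (σ ∘ π)) - φ ((lower N k).inf (σ ∘ π))) =
      condAvg φ σ τ k := by
  have hk : k < N := h.trans_lt i.2
  rw [condAvg, dif_pos hk, ← permAvg_mul_right (swap ⟨k, hk⟩ i)]
  have h' : (⟨k, hk⟩ : Fin N) ≤ i := h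
  congr 1
  funext π
  have := lower_inf_comp_swap (σ := σ) h' π
  simp only at this
  rw [this]
  simp

theorem lowerAvg_zero (hφ : IsRank φ) : lowerAvg φ σ 0 = 0 := by
  simp [lowerAvg, lower_zero, hφ.top, permAvg_const]

theorem lowerAvg_le {c : ℝ} (h : ∀ r, φ r ≤ c) (k : ℕ) : lowerAvg φ σ k ≤ c := by
  rw [← permAvg_const (N := N) c]
  exact permAvg_mono fun π => h _

theorem condAvg_nonneg (hφ : IsRank φ) (k : ℕ) : 0 ≤ condAvg φ σ τ k := by
  unfold condAvg
  split_ifs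
  · rw [← permAvg_const (N := N) 0]
    exact permAvg_mono fun π => sub_nonneg.2 (hφ.anti inf_le_right)
  · rfl

theorem lowerAvg_succ {k : ℕ} (hk : k < N) :
    lowerAvg φ σ (k + 1) = lowerAvg φ σ k + condAvg φ σ σ k := by
  rw [condAvg, dif_pos hk, permAvg_sub, lowerAvg, lowerAvg, lower_succ hk]
  simp [Finset.inf_insert]

theorem condAvg_mono_right (hφ : IsRank φ) (h : ∀ n, σ n ≤ τ n) (k : ℕ) :
    condAvg φ σ τ k ≤ condAvg φ σ σ k := by
  unfold condAvg
  split_ifs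
  · exact permAvg_mono fun π => sub_le_sub_right (hφ.anti (inf_le_inf_right _ (h _))) _
  · rfl

theorem condAvg_succ_le (hφ : IsRank φ) (k : ℕ) :
    condAvg φ σ τ (k + 1) ≤ condAvg φ σ τ k := by
  by_cases hk : k + 1 < N
  · rw [← permAvg_cond_eq (i := ⟨k + 1, hk⟩) (k := k) (Nat.le_succ k), condAvg, dif_pos hk]
    refine permAvg_mono fun π => hφ.cond_anti _ (Finset.inf_mono fun i hi => ?_)
    rw [mem_lower] at hi ⊢
    omega
  -- Out of range, `condAvg` is `0` by convention.
  · rw [condAvg, dif_neg hk]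
    exact condAvg_nonneg hφ k

/-- Han's inequality: the average rank per variable is nonincreasing. -/
theorem mul_lowerAvg_le (hφ : IsRank φ) {k l : ℕ} (hkl : k ≤ l) (hl : l ≤ N) :
    (k : ℝ) * lowerAvg φ σ l ≤ l * lowerAvg φ σ k := by
  -- `lowerAvg` at `k` is the sum of `k` nonincreasing increments, each at least the next one.
  have step : ∀ k, k < N → (k : ℝ) * condAvg φ σ σ k ≤ lowerAvg φ σ k := by
    intro k
    induction k with
    | zero => intro _; simp [lowerAvg_zero hφ]
    | succ k ih =>
      intro hk
      rw [lowerAvg_succ (by omega)]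
      have h1 := ih (by omega)
      have h2 := condAvg_succ_le (σ := σ) (τ := σ) hφ k
      have h3 : (0 : ℝ) ≤ k := Nat.cast_nonneg k
      push_cast
      nlinarith
  induction l, hkl using Nat.le_induction with
  | base => exact le_rfl
  | succ l hkl ih =>
    have h1 := ih (by omega)
    have h2 := step l (by omega)
    rw [lowerAvg_succ (by omega)]
    rcases Nat.eq_zero_or_pos l with rfl | hl0
    · obtain rfl : k = 0 := by omega
      simp [lowerAvg_zero hφ]
    have hl0' : (0 : ℝ) < l := by exact_mod_cast hl0
    have h3 : (k : ℝ) * (l * condAvg φ σ σ l) ≤ k * lowerAvg φ σ l := by gcongr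
    have h4 : (l : ℝ) * (k * (lowerAvg φ σ l + condAvg φ σ σ l)) ≤
        l * (((l + 1 : ℕ) : ℝ) * lowerAvg φ σ k) := by
      push_cast
      nlinarith
    exact le_of_mul_le_mul_left h4 hl0'

/-- Chain rule, then subadditivity of the `j` variables `τ` given the `N - j` variables `σ`; by
symmetry all summands have the same average. -/
theorem mixedAvg_le (hφ : IsRank φ) {j : ℕ} (hj : j ≤ N) :
    mixedAvg φ σ τ (N - j) ≤ lowerAvg φ σ (N - j) + j * condAvg φ σ τ (N - j) := by
  have h : permAvg (fun π : Perm (Fin N) =>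
      φ ((upper N (N - j)).inf (τ ∘ π) ⊓ (lower N (N - j)).inf (σ ∘ π))
        - φ ((lower N (N - j)).inf (σ ∘ π))) ≤ j * condAvg φ σ τ (N - j) := by
    calc _ ≤ permAvg (fun π : Perm (Fin N) => ∑ i ∈ upper N (N - j),
          (φ (τ (π i) ⊓ (lower N (N - j)).inf (σ ∘ π)) - φ ((lower N (N - j)).inf (σ ∘ π)))) :=
        permAvg_mono fun π => hφ.cond_inf_le _ (τ ∘ π) _
      _ = j * condAvg φ σ τ (N - j) := by
        rw [permAvg_sum, Finset.sum_congr rfl fun i hi => permAvg_cond_eq (mem_upper.1 hi),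
          Finset.sum_const, card_upper (Nat.sub_le _ _), nsmul_eq_mul, Nat.sub_sub_self hj]
  rw [permAvg_sub] at h
  unfold mixedAvg lowerAvg
  linarith

/-- Reveal the variables `τ` one at a time. The rest is conditioned on the revealed `τ n`;
conditioning on the finer `σ n` instead can only lower its rank, and restores the form needed for
the next step. -/
theorem le_mixedAvg (hφ : IsRank φ) (h : ∀ n, σ n ≤ τ n) {m : ℕ} (hm : m ≤ N) :
    lowerAvg φ σ (N - m) + ∑ j ∈ Finset.Icc 1 m, condAvg φ σ τ (N - j) ≤
      mixedAvg φ σ τ (N - m) := by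
  induction m with
  | zero => simp [mixedAvg, upper_self, lowerAvg]
  | succ m ih =>
    have ih := ih (by omega)
    have hk : N - (m + 1) < N := by omega
    have hk1 : N - (m + 1) + 1 = N - m := by omega
    set k := N - (m + 1) with hkdef
    rw [Finset.sum_Icc_succ_top (by omega), ← hkdef]
    have h1 : mixedAvg φ σ τ (N - m) - lowerAvg φ σ (N - m) ≤
        mixedAvg φ σ τ k - (lowerAvg φ σ k + condAvg φ σ τ k) := by
      have e : lowerAvg φ σ k + condAvg φ σ τ k = permAvg fun π =>
          φ (τ (π ⟨k, hk⟩) ⊓ (lower N k).inf (σ ∘ π)) := by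
        rw [condAvg, dif_pos hk, permAvg_sub, lowerAvg]
        ring
      rw [e, mixedAvg, lowerAvg, mixedAvg, ← permAvg_sub, ← permAvg_sub]
      refine permAvg_mono fun π => ?_
      rw [← hk1, upper_eq_insert hk, Finset.inf_insert, lower_succ hk, Finset.inf_insert]
      have := hφ.cond_anti ((upper N (k + 1)).inf (τ ∘ π))
        (inf_le_inf_right ((lower N k).inf (σ ∘ π)) (h (π ⟨k, hk⟩)))
      rw [inf_comm ((τ ∘ π) _), inf_assoc]
      exact this
    linarith

/-- The transposition of `x` and the last position `k` carries the erased set onto `lower N k`. -/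
theorem permAvg_erase_eq {k : ℕ} (hk : k < N) {x : Fin N} (hx : x ∈ lower N (k + 1)) :
    permAvg (fun π => φ (((lower N (k + 1)).erase x).inf (σ ∘ π) ⊓ τ (π x))) =
      lowerAvg φ σ k + condAvg φ σ τ k := by
  have e : lowerAvg φ σ k + condAvg φ σ τ k = permAvg fun π =>
      φ (τ (π ⟨k, hk⟩) ⊓ (lower N k).inf (σ ∘ π)) := by
    rw [condAvg, dif_pos hk, permAvg_sub, lowerAvg]
    ring
  rw [e, ← permAvg_mul_right (swap ⟨k, hk⟩ x)]
  congr 1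
  funext π
  rw [inf_comm]
  have hset : ((lower N (k + 1)).erase x).map (swap ⟨k, hk⟩ x).toEmbedding = lower N k := by
    ext i
    rw [Finset.mem_map_equiv, symm_swap, Finset.mem_erase, mem_lower, mem_lower]
    rw [mem_lower] at hx
    by_cases h1 : i = ⟨k, hk⟩
    · subst h1; simp
    · by_cases h2 : i = x
      · subst h2
        have : (i : ℕ) ≠ k := fun h => h1 (Fin.ext h)
        simp only [swap_apply_right, lt_add_iff_pos_right, Nat.lt_one_iff, pos_of_gt, and_true]
        constructor
        · intro _; omega
        · intro _ h; exact this (congrArg Fin.val h).symm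
      · rw [swap_apply_of_ne_of_ne h1 h2]
        have : (i : ℕ) ≠ k := fun h => h1 (Fin.ext h)
        constructor
        · rintro ⟨_, h⟩; omega
        · intro h; exact ⟨h2, by omega⟩
  rw [← hset, Finset.inf_map]
  simp [Function.comp_def]

/-- Submodularity interpolates between one variable `τ` among variables `σ` and the two families
alone. -/
theorem le_mul_lowerAvg_add_condAvg (hφ : IsRank φ) (h : ∀ n, σ n ≤ τ n) {k : ℕ} (hk : k < N) :
    (k : ℝ) * lowerAvg φ σ (k + 1) + lowerAvg φ τ (k + 1) ≤
      (k + 1) * (lowerAvg φ σ k + condAvg φ σ τ k) := by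
  have hne : (lower N (k + 1)).Nonempty := ⟨⟨k, hk⟩, by simp [mem_lower]⟩
  have e : ((k : ℝ) + 1) * (lowerAvg φ σ k + condAvg φ σ τ k) =
      permAvg fun π => ∑ x ∈ lower N (k + 1),
        φ (((lower N (k + 1)).erase x).inf (σ ∘ π) ⊓ τ (π x)) := by
    rw [permAvg_sum, Finset.sum_congr rfl fun x hx => permAvg_erase_eq hk hx, Finset.sum_const,
      card_lower hk, nsmul_eq_mul]
    push_cast
    ring
  rw [e, lowerAvg, lowerAvg, ← permAvg_const_mul, ← permAvg_add]
  refine permAvg_mono fun π => ?_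
  -- Han's inequality conditional on all the variables `τ`. Among them only `τ (π x)` survives next
  -- to the `σ` at the positions other than `x`, since these determine the rest.
  have h1 := hφ.han_erase (σ ∘ π) (lower N (k + 1)) hne ((lower N (k + 1)).inf (τ ∘ π))
  rw [card_lower hk] at h1
  have h2 : (lower N (k + 1)).inf (σ ∘ π) ≤ (lower N (k + 1)).inf (τ ∘ π) :=
    Finset.inf_mono_fun fun i _ => h (π i)
  rw [inf_eq_left.2 h2] at h1
  have h3 : ∀ x ∈ lower N (k + 1), φ (((lower N (k + 1)).erase x).inf (σ ∘ π) ⊓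
      (lower N (k + 1)).inf (τ ∘ π)) = φ (((lower N (k + 1)).erase x).inf (σ ∘ π) ⊓ τ (π x)) := by
    intro x hx
    congr 1
    apply le_antisymm
    · exact inf_le_inf_left _ (Finset.inf_le (f := τ ∘ π) hx)
    · refine le_inf inf_le_left (Finset.le_inf fun i hi => ?_)
      by_cases hix : i = x
      · subst hix; exact inf_le_right
      · exact inf_le_left.trans ((Finset.inf_le (Finset.mem_erase.2 ⟨hix, hi⟩)).trans (h (π i)))
  rw [Finset.sum_congr rfl h3] at h1
  push_cast at h1
  linarith

theorem mixedAvg_zero : mixedAvg φ σ τ 0 = lowerAvg φ τ N := by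
  have h : upper N 0 = lower N N := by
    ext i
    simp [mem_lower, mem_upper]
  simp [mixedAvg, lowerAvg, lower_zero, h]

/-- Subadditivity, each position being uniform over the servers; the right side is what the storage
and download costs will bound. -/
theorem mixedAvg_le_sum (hφ : IsRank φ) {m : ℕ} (hm : m ≤ N) :
    mixedAvg φ σ τ (N - m) ≤
      (m : ℝ) * ((∑ n, φ (τ n)) / N) + ((N : ℝ) - m) * ((∑ n, φ (σ n)) / N) := by
  have hs : ∀ (ρ : Fin N → α) (I : Finset (Fin N)),
      permAvg (fun π => ∑ i ∈ I, φ (ρ (π i))) = I.card * ((∑ n, φ (ρ n)) / N) := by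
    intro ρ I
    rw [permAvg_sum, Finset.sum_congr rfl fun i _ => permAvg_apply i fun n => φ (ρ n)]
    simp
  have h1 := hs τ (upper N (N - m))
  have h2 := hs σ (lower N (N - m))
  rw [card_upper (Nat.sub_le _ _), Nat.sub_sub_self hm] at h1
  rw [card_lower (Nat.sub_le _ _), Nat.cast_sub hm] at h2
  rw [← h1, ← h2, ← permAvg_add]
  refine permAvg_mono fun π => ?_
  have h3 := hφ.sub ((upper N (N - m)).inf (τ ∘ π)) ((lower N (N - m)).inf (σ ∘ π)) ⊤
  have h4 := hφ.cond_inf_le (upper N (N - m)) (τ ∘ π) ⊤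
  have h5 := hφ.cond_inf_le (lower N (N - m)) (σ ∘ π) ⊤
  simp only [inf_top_eq, hφ.top, sub_zero, add_zero, Function.comp_apply] at h3 h4 h5
  linarith

end PermAvg

/-! ### The linear program for three or more messages. -/

section Thresholds

variable {N m : ℕ}

theorem jStar_mem (hm : 2 ≤ m) (hmN : m ≤ N) :
    2 ≤ jStar N m ∧ jStar N m ≤ m ∧
      ∑ i ∈ Finset.Icc (jStar N m + 1) m, ((N : ℝ) - (i : ℝ) + 1) / ((i : ℝ) - 1) ≤
        ((m : ℝ) - 1) * ((N : ℝ) - (m : ℝ)) / (m : ℝ) := by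
  have hne : {j : ℕ | 2 ≤ j ∧ j ≤ m ∧
      ∑ i ∈ Finset.Icc (j + 1) m, ((N : ℝ) - (i : ℝ) + 1) / ((i : ℝ) - 1) ≤
        ((m : ℝ) - 1) * ((N : ℝ) - (m : ℝ)) / (m : ℝ)}.Nonempty := by
    refine ⟨m, hm, le_rfl, ?_⟩
    have h1 : (2 : ℝ) ≤ m := by exact_mod_cast hm
    have h2 : (m : ℝ) ≤ N := by exact_mod_cast hmN
    rw [Finset.Icc_eq_empty (by omega), Finset.sum_empty]
    exact div_nonneg (mul_nonneg (by linarith) (by linarith)) (by linarith)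
  exact Nat.sInf_mem hne

/-- Minimality of the threshold: the coefficient of the last term of the recursion is at most
`1 / (j* - 1)`. -/
theorem jStar_minimal (hm : 2 ≤ m) (hmN : m ≤ N) :
    ((m : ℝ) - 1) * ((N : ℝ) - (m : ℝ)) / (m : ℝ) -
      ∑ i ∈ Finset.Icc (jStar N m + 1) m, ((N : ℝ) - (i : ℝ) + 1) / ((i : ℝ) - 1) ≤
        ((N : ℝ) - jStar N m + 1) / ((jStar N m : ℝ) - 1) := by
  obtain ⟨h2, hle, -⟩ := jStar_mem hm hmN
  have hm1 : (2 : ℝ) ≤ m := by exact_mod_cast hm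
  have hmN' : (m : ℝ) ≤ N := by exact_mod_cast hmN
  rcases h2.eq_or_lt with heq | hlt
  · rw [← heq]
    have h3 : 0 ≤ ∑ i ∈ Finset.Icc (2 + 1) m, ((N : ℝ) - (i : ℝ) + 1) / ((i : ℝ) - 1) := by
      refine Finset.sum_nonneg fun i hi => ?_
      obtain ⟨hi1, hi2⟩ := Finset.mem_Icc.1 hi
      have hi1' : (3 : ℝ) ≤ i := by exact_mod_cast hi1
      have hi2' : (i : ℝ) ≤ m := by exact_mod_cast hi2
      exact div_nonneg (by linarith) (by linarith)
    have h4 : ((m : ℝ) - 1) * ((N : ℝ) - (m : ℝ)) / (m : ℝ) ≤ (N : ℝ) - 1 := by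
      rw [div_le_iff₀ (by linarith)]
      nlinarith
    norm_num at h3 ⊢
    linarith
  · have hnot : jStar N m - 1 ∉ {j : ℕ | 2 ≤ j ∧ j ≤ m ∧
        ∑ i ∈ Finset.Icc (j + 1) m, ((N : ℝ) - (i : ℝ) + 1) / ((i : ℝ) - 1) ≤
          ((m : ℝ) - 1) * ((N : ℝ) - (m : ℝ)) / (m : ℝ)} :=
      Nat.notMem_of_lt_sInf (show jStar N m - 1 < jStar N m by omega)
    have h3 : ((m : ℝ) - 1) * ((N : ℝ) - (m : ℝ)) / (m : ℝ) <
        ∑ i ∈ Finset.Icc (jStar N m) m, ((N : ℝ) - (i : ℝ) + 1) / ((i : ℝ) - 1) := by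
      by_contra hcon
      refine hnot ⟨by omega, by omega, ?_⟩
      rw [Nat.sub_add_cancel (by omega)]
      exact not_lt.1 hcon
    rw [← Finset.insert_Icc_add_one_left_eq_Icc hle, Finset.sum_insert (by simp)] at h3
    linarith

/-- Relates the coefficients produced by the weights `1 / j` to the sum that defines `jStar`. -/
theorem sum_shift {j : ℕ} (hj : j ≤ m) :
    ∑ i ∈ Finset.Icc j m, ((N : ℝ) - i) / i =
      ((N : ℝ) - m) / m +
        ∑ i ∈ Finset.Icc (j + 1) m, ((N : ℝ) - (i : ℝ) + 1) / ((i : ℝ) - 1) := by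
  induction m, hj using Nat.le_induction with
  | base => simp
  | succ m hj ih =>
    rw [Finset.sum_Icc_succ_top (by omega), ih, Finset.sum_Icc_succ_top (by omega)]
    push_cast
    ring

/-- Linear programming duality: add the constraints `hprev j` with weight `1 / j` for `j* ≤ j ≤ m`
and weight `c` at `j* - 1`, then replace every `σ j` by a multiple of `σ m` using `hσ`. The weight
`c` is what makes the coefficients of `σ m` sum to one. -/
theorem formulaStep_le (hm : 2 ≤ m) (hmN : m < N) {l : ℝ} {σ a prev : ℕ → ℝ}
    (ha : ∀ j, 0 ≤ a j)
    (hσ : ∀ j ≤ m, ((N : ℝ) - m) * σ j ≤ ((N : ℝ) - j) * σ m)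
    (hprev : ∀ j, 1 ≤ j → j ≤ m → l * prev j ≤ σ j + j * a j) :
    l * formulaStep N m (jStar N m) prev ≤ l + (σ m + ∑ j ∈ Finset.Icc 1 m, a j) := by
  obtain ⟨hj2, hjm, hD⟩ := jStar_mem hm hmN.le
  have hmin := jStar_minimal hm hmN.le
  unfold formulaStep
  rw [mul_comm ((N : ℝ) - m) ((m : ℝ) - 1)]
  have hshift := sum_shift (N := N) hjm
  obtain ⟨q, hq⟩ : ∃ q, jStar N m = q + 1 := ⟨jStar N m - 1, by omega⟩
  rw [hq] at hj2 hjm hD hmin hshift ⊢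
  rw [Nat.add_sub_cancel]
  set S := ∑ i ∈ Finset.Icc (q + 1 + 1) m, ((N : ℝ) - (i : ℝ) + 1) / ((i : ℝ) - 1) with hS
  set D := ((m : ℝ) - 1) * ((N : ℝ) - (m : ℝ)) / (m : ℝ) - S with hDdef
  have hD0 : 0 ≤ D := by linarith
  push_cast at hmin ⊢
  have hq1 : (1 : ℝ) ≤ q := by exact_mod_cast (by omega : 1 ≤ q)
  have hqm : (q : ℝ) + 1 ≤ m := by exact_mod_cast hjm
  have hmN' : (m : ℝ) + 1 ≤ N := by exact_mod_cast hmN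
  have hNq : (0 : ℝ) < N - q := by linarith
  have e1 : (N : ℝ) - (q + 1) + 1 = N - q := by ring
  have e2 : (q : ℝ) + 1 - 1 = q := by ring
  rw [e1] at hmin ⊢
  rw [e2] at hmin
  set c := 1 / ((N : ℝ) - q) * D with hc
  have hc0 : 0 ≤ c := by positivity
  have hcD : c * (N - q) = D := by rw [hc]; field_simp
  -- Minimality of `j*` ensures that the last constraint uses at most one copy of `a q`.
  have hcq : c * q ≤ 1 := by
    rw [le_div_iff₀ (by linarith), ← hcD] at hmin
    nlinarith
  set x := σ m / ((N : ℝ) - m) with hx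
  have hNm : (0 : ℝ) < N - m := by linarith
  have hxm : σ m = (N - m) * x := by rw [hx]; field_simp
  have hσx : ∀ j ≤ m, σ j ≤ (N - j) * x := by
    intro j hj
    have := hσ j hj
    rw [hxm] at this
    have h' : ((N : ℝ) - m) * σ j ≤ (N - m) * ((N - j) * x) := by linarith
    exact le_of_mul_le_mul_left h' hNm
  have hlast : c * (l * prev q) ≤ a q + c * ((N - q) * x) := by
    have h1 := hprev q (by omega) (by omega)
    have h2 := hσx q (by omega)
    have h3 : c * (l * prev q) ≤ c * ((N - q) * x + q * a q) :=
      mul_le_mul_of_nonneg_left (by linarith) hc0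
    have h4 : c * q * a q ≤ 1 * a q := mul_le_mul_of_nonneg_right hcq (ha q)
    linarith
  have hmain : ∑ j ∈ Finset.Icc (q + 1) m, (1 / (j : ℝ)) * (l * prev j) ≤
      ∑ j ∈ Finset.Icc (q + 1) m, a j + (∑ j ∈ Finset.Icc (q + 1) m, ((N : ℝ) - j) / j) * x := by
    rw [Finset.sum_mul, ← Finset.sum_add_distrib]
    refine Finset.sum_le_sum fun j hj => ?_
    obtain ⟨hj1, hj2⟩ := Finset.mem_Icc.1 hj
    have hj0 : (0 : ℝ) < j := by exact_mod_cast (by omega : 0 < j)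
    have h1 := hprev j (by omega) hj2
    have h2 := hσx j hj2
    rw [one_div_mul_eq_div, div_le_iff₀ hj0]
    have e : (a j + ((N : ℝ) - j) / j * x) * j = (N - j) * x + j * a j := by
      field_simp
      ring
    rw [e]
    linarith
  have hsum : a q + ∑ j ∈ Finset.Icc (q + 1) m, a j ≤ ∑ j ∈ Finset.Icc 1 m, a j := by
    rw [← Finset.sum_insert (s := Finset.Icc (q + 1) m) (a := q) (by simp)]
    refine Finset.sum_le_sum_of_subset_of_nonneg ?_ fun i _ _ => ha i
    intro i hi
    rw [Finset.mem_insert, Finset.mem_Icc] at hi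
    rw [Finset.mem_Icc]
    omega
  have hsplit : l * (1 + ∑ j ∈ Finset.Icc (q + 1) m, 1 / (j : ℝ) * prev j + c * prev q) =
      l + ∑ j ∈ Finset.Icc (q + 1) m, (1 / (j : ℝ)) * (l * prev j) + c * (l * prev q) := by
    rw [mul_add, mul_add, Finset.mul_sum, mul_one]
    congr 1
    · congr 1
      exact Finset.sum_congr rfl fun j _ => by ring
    · ring
  -- The coefficients of `x` add up to `(N - m) / m + (m - 1) (N - m) / m = N - m`.
  have hbal : σ m = (∑ j ∈ Finset.Icc (q + 1) m, ((N : ℝ) - j) / j) * x + c * ((N - q) * x) := by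
    rw [← mul_assoc, hcD, hshift, hxm, hDdef]
    have : (m : ℝ) ≠ 0 := by linarith
    field_simp
    ring
  rw [hsplit]
  linarith

end Thresholds

/-! ### The linear program for two messages. -/

section TwoMessages

variable {N m : ℕ}

/-- A closed form of the two-message bound in terms of `p = j* - 1`. -/
theorem formulaTwo_eq {p : ℕ} (hp : 1 ≤ p) (hpm : p + 1 ≤ m) (hmN : m < N) :
    formulaTwo N m (p + 1) =
      2 - ((m : ℝ) * (m - 1) - p * (p - 1)) / (2 * (N - p)) / N := by
  have hp' : (1 : ℝ) ≤ p := by exact_mod_cast hp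
  have hpm' : (p : ℝ) + 1 ≤ m := by exact_mod_cast hpm
  have hmN' : (m : ℝ) + 1 ≤ N := by exact_mod_cast hmN
  have hN : (N : ℝ) ≠ 0 := by linarith
  -- The sum telescopes because `(m - j) (m + j - 1) = m (m - 1) - j (j - 1)`.
  have hsum : ∀ n, p ≤ n → ∑ j ∈ Finset.Icc (p + 1) n,
      (((m : ℝ) - (j : ℝ)) * ((m : ℝ) + (j : ℝ) - 1)) / (2 * (j : ℝ) * ((j : ℝ) - 1) * (N : ℝ)) =
      ((m : ℝ) * (m - 1) * (1 / p - 1 / n) - (n - p)) / (2 * N) := by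
    intro n hn
    induction n, hn using Nat.le_induction with
    | base => simp
    | succ n hn ih =>
      rw [Finset.sum_Icc_succ_top (by omega), ih]
      have hn' : (1 : ℝ) ≤ n := by exact_mod_cast hp.trans hn
      push_cast
      rw [add_sub_cancel_right]
      field_simp
      ring
  unfold formulaTwo
  rw [hsum (m - 1) (by omega), Nat.cast_sub (by omega)]
  have h1 : (N : ℝ) - p ≠ 0 := by linarith
  have h2 : (m : ℝ) - 1 ≠ 0 := by linarith
  have h3 : (p : ℝ) ≠ 0 := by linarith
  have h4 : (N : ℝ) - (p + 1) ≠ 0 := by linarith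
  push_cast
  have e1 : (N : ℝ) - (p + 1) + 1 = N - p := by ring
  have e2 : (p : ℝ) + 1 - 1 = p := by ring
  rw [e1, e2]
  field_simp
  ring

theorem two_le_jStarTwo : 2 ≤ jStarTwo N m := le_max_left _ _

theorem jStarTwo_le (hm : 2 ≤ m) (hmN : m ≤ N) : jStarTwo N m ≤ m := by
  have hm' : (2 : ℝ) ≤ m := by exact_mod_cast hm
  have hmN' : (m : ℝ) ≤ N := by exact_mod_cast hmN
  refine max_le hm (Nat.ceil_le.2 ?_)
  have : (N : ℝ) - m + 1 / 2 ≤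
      Real.sqrt (((N : ℝ) - (m : ℝ)) * ((N : ℝ) + (m : ℝ) - 1) + 1 / 4) := by
    apply Real.le_sqrt_of_sq_le
    nlinarith [mul_nonneg (sub_nonneg.2 hmN') (by linarith : (0 : ℝ) ≤ m - 1)]
  linarith

/-- The real number inside the ceiling of `jStarTwo` is the smaller root of `(j - 1) (2 N - j) = m
(m - 1)`; the claim is the side `j = i + 1` at or beyond that root, and `le_of_lt_jStarTwo` is the
other side. -/
theorem le_of_jStarTwo_le {i : ℕ} (hm : 1 ≤ m) (hmN : m ≤ N) (hiN : i + 1 ≤ N)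
    (h : jStarTwo N m ≤ i + 1) :
    (m : ℝ) * (m - 1) - (i + 1) * i ≤ i * (2 * (N - (i + 1))) := by
  have hm' : (1 : ℝ) ≤ m := by exact_mod_cast hm
  have hmN' : (m : ℝ) ≤ N := by exact_mod_cast hmN
  have hiN' : (i : ℝ) + 1 ≤ N := by exact_mod_cast hiN
  have h1 := Nat.ceil_le.1 ((le_max_right _ _).trans h)
  push_cast at h1
  have h2 : (N : ℝ) - 1 / 2 - i ≤
      Real.sqrt (((N : ℝ) - (m : ℝ)) * ((N : ℝ) + (m : ℝ) - 1) + 1 / 4) := by linarith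
  rw [Real.le_sqrt' (by linarith)] at h2
  nlinarith

theorem le_of_lt_jStarTwo {p : ℕ} (hpN : p ≤ N) (hm : 1 ≤ m) (hmN : m ≤ N) (hp : 2 ≤ p)
    (h : p < jStarTwo N m) :
    ((p : ℝ) - 1) * (2 * (N - p)) ≤ (m : ℝ) * (m - 1) - p * (p - 1) := by
  have hm' : (1 : ℝ) ≤ m := by exact_mod_cast hm
  have hmN' : (m : ℝ) ≤ N := by exact_mod_cast hmN
  have hpN' : (p : ℝ) ≤ N := by exact_mod_cast hpN
  have h1 := Nat.lt_ceil.1 ((lt_max_iff.1 h).resolve_left (by omega))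
  have h2 : Real.sqrt (((N : ℝ) - (m : ℝ)) * ((N : ℝ) + (m : ℝ) - 1) + 1 / 4) <
      (N : ℝ) + 1 / 2 - p := by linarith
  rw [Real.sqrt_lt' (by linarith)] at h2
  nlinarith

/-- The value of a linear program with constraints `∑_{i < j} z i + (N - j) z j ≤ b`. -/
theorem sum_mul_le_of_prefix_le {p : ℕ} {b : ℝ} {z : ℕ → ℝ} (hp : 1 ≤ p) (hpm : p + 1 ≤ m)
    (hmN : m < N) (hz : ∀ j, 1 ≤ j → j < m → 0 ≤ z j)
    (hle : ∀ j, 1 ≤ j → j < m → ∑ i ∈ Finset.Ico 1 j, z i + ((N : ℝ) - j) * z j ≤ b)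
    (hlarge : ∀ i, p ≤ i → i < m → (m : ℝ) * (m - 1) - (i + 1) * i ≤ i * (2 * (N - (i + 1))))
    (hsmall : ((p : ℝ) - 1) * (2 * (N - p)) ≤ (m : ℝ) * (m - 1) - p * (p - 1)) :
    ∑ j ∈ Finset.Ico 1 m, (j : ℝ) * z j ≤
      ((m : ℝ) * (m - 1) - p * (p - 1)) / (2 * (N - p)) * b := by
  -- `Λ i` is the optimal value per unit of remaining budget when only `z i, …, z (m - 1)` are used,
  -- for `i ≥ p`. It solves the backward recursion `hrec` with `Λ m = 0`.
  set Λ : ℕ → ℝ := fun i => ((m : ℝ) * (m - 1) - i * (i - 1)) / (2 * (N - i)) with hΛ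
  have hmN' : (m : ℝ) + 1 ≤ N := by exact_mod_cast hmN
  have htail : ∀ d, p + d ≤ m → ∑ j ∈ Finset.Ico (m - d) m, (j : ℝ) * z j ≤
      Λ (m - d) * (b - ∑ i ∈ Finset.Ico 1 (m - d), z i) := by
    intro d
    induction d with
    | zero => intro _; simp [hΛ]
    | succ d ih =>
      intro hd
      have ih := ih (by omega)
      obtain ⟨i, hi⟩ : ∃ i, i = m - (d + 1) := ⟨_, rfl⟩
      have hi1 : m - d = i + 1 := by omega
      have him : i + 1 ≤ m := by omega
      rw [hi1, Finset.sum_Ico_succ_top (by omega : 1 ≤ i)] at ih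
      rw [← hi, Finset.sum_eq_sum_Ico_succ_bot (by omega : i < m)]
      have h1 := hlarge i (by omega) (by omega)
      have h2 := hle i (by omega) (by omega)
      have him' : (i : ℝ) + 1 ≤ m := by exact_mod_cast him
      have hNi : (0 : ℝ) < N - i := by linarith
      have hNi1 : (0 : ℝ) < 2 * (N - (i + 1)) := by linarith
      -- This sign makes it legitimate to use the constraint at `i` with the multiplier `i - Λ (i +
      -- 1)`.
      have hΛi : Λ (i + 1) ≤ i := by
        simp only [hΛ]
        push_cast
        rw [div_le_iff₀ hNi1, add_sub_cancel_right]
        exact h1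
      have hrec : (N - i) * Λ i = i + (N - i - 1) * Λ (i + 1) := by
        simp only [hΛ]
        push_cast
        have : (N : ℝ) - (i + 1) ≠ 0 := by linarith
        field_simp
        ring
      set P := ∑ j ∈ Finset.Ico 1 i, z j
      have h3 : ((i : ℝ) - Λ (i + 1)) * ((N - i) * z i) ≤ (i - Λ (i + 1)) * (b - P) :=
        mul_le_mul_of_nonneg_left (by linarith) (by linarith)
      have h4 : (N - i) * ((i : ℝ) * z i + ∑ j ∈ Finset.Ico (i + 1) m, (j : ℝ) * z j) ≤
          (N - i) * (Λ i * (b - P)) := by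
        have h5 : (N - i) * ∑ j ∈ Finset.Ico (i + 1) m, (j : ℝ) * z j ≤
            (N - i) * (Λ (i + 1) * (b - (P + z i))) := mul_le_mul_of_nonneg_left ih hNi.le
        rw [← mul_assoc ((N : ℝ) - i) (Λ i), hrec]
        nlinarith
      exact le_of_mul_le_mul_left h4 hNi
  have h1 := htail (m - p) (by omega)
  rw [Nat.sub_sub_self (by omega)] at h1
  have h2 : ∑ j ∈ Finset.Ico 1 p, (j : ℝ) * z j ≤ (p - 1) * ∑ j ∈ Finset.Ico 1 p, z j := by
    rw [Finset.mul_sum]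
    refine Finset.sum_le_sum fun j hj => ?_
    obtain ⟨hj1, hj2⟩ := Finset.mem_Ico.1 hj
    have : (j : ℝ) + 1 ≤ p := by exact_mod_cast hj2
    exact mul_le_mul_of_nonneg_right (by linarith) (hz j hj1 (by omega))
  -- Below `p` the gain `j ≤ p - 1` per unit of `z j` does not exceed the value `Λ p` of the budget
  -- it consumes.
  have h3 : (p : ℝ) - 1 ≤ Λ p := by
    have : (p : ℝ) + 1 ≤ m := by exact_mod_cast hpm
    simp only [hΛ]
    rw [le_div_iff₀ (by linarith)]
    exact hsmall
  have h4 : 0 ≤ ∑ j ∈ Finset.Ico 1 p, z j := Finset.sum_nonneg fun j hj => by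
    obtain ⟨hj1, hj2⟩ := Finset.mem_Ico.1 hj
    exact hz j hj1 (by omega)
  rw [← Finset.sum_Ico_consecutive _ hp (by omega : p ≤ m)]
  change _ ≤ Λ p * b
  nlinarith

/-- With slacks `j * z j` in the inequalities `he`, the objective telescopes to `σ 1 + a 1 - ∑ j * z
j`, where `σ 1 + a 1 ≥ l`. The loss is then bounded by `sum_mul_le_of_prefix_le` with budget `l /
N`. -/
theorem formulaTwo_le (hm : 2 ≤ m) (hmN : m < N) {l : ℝ} {σ a : ℕ → ℝ}
    (hσ : ∀ j, σ j ≤ l) (hl : ∀ j, 1 ≤ j → j ≤ m → l ≤ σ j + j * a j)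
    (he : ∀ j < m, σ (j + 1) + a (j + 1) ≤ σ j)
    (hmix : ∀ j < m, ((N : ℝ) - j - 1) * σ j + (N - j) * (l / N) ≤
      (N - j) * (σ (j + 1) + a (j + 1))) :
    l * formulaTwo N m (jStarTwo N m) ≤ l + (σ m + ∑ j ∈ Finset.Icc 1 m, a j) := by
  have hmN' : (m : ℝ) + 1 ≤ N := by exact_mod_cast hmN
  have hm' : (2 : ℝ) ≤ m := by exact_mod_cast hm
  have hN : (0 : ℝ) < N := by linarith
  obtain ⟨p, hp⟩ : ∃ p, jStarTwo N m = p + 1 :=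
    ⟨jStarTwo N m - 1, by have := two_le_jStarTwo (N := N) (m := m); omega⟩
  have hp1 : 1 ≤ p := by have := two_le_jStarTwo (N := N) (m := m); omega
  have hpm : p + 1 ≤ m := hp ▸ jStarTwo_le hm hmN.le
  rw [hp, formulaTwo_eq hp1 hpm hmN]
  set z : ℕ → ℝ := fun j => (σ j - σ (j + 1) - a (j + 1)) / j with hz
  have hzj : ∀ j : ℕ, 1 ≤ j → (j : ℝ) * z j = σ j - σ (j + 1) - a (j + 1) := by
    intro j hj
    have : (j : ℝ) ≠ 0 := by exact_mod_cast (by omega : j ≠ 0)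
    simp only [hz]
    field_simp
  -- Inserting `a (j + 1) ≥ (l - σ (j + 1)) / (j + 1)` bounds `z j` by a difference of consecutive
  -- right sides.
  have hprefix : ∀ j, 1 ≤ j → j ≤ m → ∑ i ∈ Finset.Ico 1 j, z i ≤ (l - σ j) / j := by
    intro j hj
    induction j, hj using Nat.le_induction with
    | base => intro _; simpa using hσ 1
    | succ j hj ih =>
      intro hjm
      rw [Finset.sum_Ico_succ_top hj]
      have h1 := ih (by omega)
      have h2 := hl (j + 1) (by omega) hjm
      have hj0 : (0 : ℝ) < j := by exact_mod_cast hj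
      have h3 : z j ≤ (l - σ (j + 1)) / ((j + 1 : ℕ) : ℝ) - (l - σ j) / j := by
        have h4 : (l - σ (j + 1)) / ((j + 1 : ℕ) : ℝ) ≤ a (j + 1) := by
          rw [div_le_iff₀ (by positivity)]
          linarith
        have h5 : (l - σ (j + 1)) / ((j + 1 : ℕ) : ℝ) =
            (l - σ (j + 1)) / j - (l - σ (j + 1)) / ((j + 1 : ℕ) : ℝ) / j := by
          push_cast
          field_simp
          ring
        have h6 : (l - σ (j + 1)) / ((j + 1 : ℕ) : ℝ) / j ≤ a (j + 1) / j := by gcongr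
        rw [h5]
        simp only [hz]
        have : (σ j - σ (j + 1) - a (j + 1)) / j =
          (l - σ (j + 1)) / j - (l - σ j) / j - a (j + 1) / j := by ring
        linarith
      linarith
  have hlp := sum_mul_le_of_prefix_le (N := N) (b := l / N) (z := z) hp1 hpm hmN
    (fun j hj hjm => div_nonneg (by linarith [he j hjm]) (Nat.cast_nonneg j))
    (fun j hj hjm => by
      have h1 := hprefix j hj hjm.le
      have h2 := hmix j hjm
      have hj0 : (0 : ℝ) < j := by exact_mod_cast hj
      have hjm' : (j : ℝ) + 1 ≤ m := by exact_mod_cast hjm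
      have h3 : (j : ℝ) * (((l - σ j) / j) + ((N : ℝ) - j) * z j) ≤ j * (l / N) := by
        have e : (j : ℝ) * (((l - σ j) / j) + ((N : ℝ) - j) * z j) =
            (l - σ j) + (N - j) * (j * z j) := by
          field_simp
        have e2 : (N : ℝ) * (l / N) = l := by field_simp
        rw [e, hzj j hj]
        linarith
      have h4 := le_of_mul_le_mul_left h3 hj0
      linarith)
    (fun i hi him => le_of_jStarTwo_le (by omega) hmN.le (by omega) (by omega))
    (by
      -- For `p = 1` the outer maximum in `jStarTwo` may be decisive, but the inequality is then
      -- just `0 ≤ m (m - 1)`.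
      rcases hp1.eq_or_lt with h | h
      · subst h
        norm_num
        nlinarith
      · exact le_of_lt_jStarTwo (by omega) (by omega) hmN.le h (by omega))
  have htel : ∀ n, 1 ≤ n → σ n + ∑ j ∈ Finset.Icc 1 n, a j =
      σ 1 + a 1 - ∑ j ∈ Finset.Ico 1 n, (j : ℝ) * z j := by
    intro n hn
    induction n, hn using Nat.le_induction with
    | base => simp
    | succ n hn ih =>
      rw [Finset.sum_Icc_succ_top (by omega), Finset.sum_Ico_succ_top hn, hzj n hn]
      linarith
  have h1 := hl 1 le_rfl (by omega)
  rw [htel m (by omega)]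
  push_cast at h1
  have e : l * (2 - ((m : ℝ) * (m - 1) - p * (p - 1)) / (2 * (N - p)) / N) =
      2 * l - ((m : ℝ) * (m - 1) - p * (p - 1)) / (2 * (N - p)) * (l / N) := by ring
  rw [e]
  linarith

end TwoMessages

/-! ### Expectations under a law on a finite type. -/

section Expectation

variable {α β : Type*} [Fintype α]

/-- The expectation of a real function under a law on a finite type. -/
noncomputable def expect (p : PMF α) (g : α → ℝ) : ℝ := ∑ x, (p x).toReal * g x

theorem sum_toReal_pmf (p : PMF α) : ∑ x, (p x).toReal = 1 := by
  rw [← ENNReal.toReal_sum fun x _ => p.apply_ne_top x, ← tsum_fintype (L := .unconditional α),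
    p.tsum_coe, ENNReal.toReal_one]

theorem expect_mono {p : PMF α} {g h : α → ℝ} (hgh : ∀ x ∈ p.support, g x ≤ h x) :
    expect p g ≤ expect p h := by
  refine Finset.sum_le_sum fun x _ => ?_
  by_cases hx : x ∈ p.support
  · exact mul_le_mul_of_nonneg_left (hgh x hx) ENNReal.toReal_nonneg
  · rw [PMF.mem_support_iff, not_not] at hx
    simp [hx]

theorem expect_const (p : PMF α) (a : ℝ) : expect p (fun _ => a) = a := by
  rw [expect, ← Finset.sum_mul, sum_toReal_pmf, one_mul]

theorem expect_add (p : PMF α) (g h : α → ℝ) :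
    expect p (fun x => g x + h x) = expect p g + expect p h := by
  simp [expect, mul_add, Finset.sum_add_distrib]

theorem expect_const_mul (p : PMF α) (a : ℝ) (g : α → ℝ) :
    expect p (fun x => a * g x) = a * expect p g := by
  rw [expect, expect, Finset.mul_sum]
  exact Finset.sum_congr rfl fun x _ => by ring

theorem expect_sum {ι : Type*} (p : PMF α) (I : Finset ι) (g : ι → α → ℝ) :
    expect p (fun x => ∑ i ∈ I, g i x) = ∑ i ∈ I, expect p (g i) := by
  simp only [expect, Finset.mul_sum]
  exact Finset.sum_comm

theorem expect_permAvg {N : ℕ} (p : PMF α) (g : Equiv.Perm (Fin N) → α → ℝ) :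
    expect p (fun x => permAvg fun π => g π x) = permAvg fun π => expect p (g π) := by
  simp only [permAvg]
  rw [← expect_sum, div_eq_inv_mul, ← expect_const_mul]
  congr 1
  funext x
  rw [div_eq_inv_mul]

/-- Here `β` may be infinite, as the key alphabet is, so the change of variables takes place in
`ℝ≥0∞`. -/
theorem sum_map_mul (p : PMF β) (h : β → α) (g : α → ℝ≥0∞) :
    ∑ x, p.map h x * g x = ∑' b, p b * g (h b) := by
  classical
  simp_rw [PMF.map_apply, ← ENNReal.tsum_mul_right]
  rw [← Summable.tsum_finsetSum fun _ _ => ENNReal.summable]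
  refine tsum_congr fun b => ?_
  simp [ite_mul]

theorem expect_map [Fintype β] (p : PMF β) (h : β → α) (g : α → ℝ) :
    expect (p.map h) g = expect p (g ∘ h) := by
  classical
  have e : ∀ x, (p.map h x).toReal * g x = ∑ b, if x = h b then (p b).toReal * g x else 0 := by
    intro x
    rw [PMF.map_apply, tsum_fintype, ENNReal.toReal_sum, Finset.sum_mul]
    · exact Finset.sum_congr rfl fun b _ => by split_ifs <;> simp
    · intro b _
      split_ifs
      · exact p.apply_ne_top b
      · exact ENNReal.zero_ne_top
  rw [expect, Finset.sum_congr rfl fun x _ => e x, Finset.sum_comm]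
  simp [expect]

theorem ofReal_expect (p : PMF α) {g : α → ℝ} (hg : ∀ x, 0 ≤ g x) :
    ENNReal.ofReal (expect p g) = ∑ x, p x * ENNReal.ofReal (g x) := by
  rw [expect, ENNReal.ofReal_sum_of_nonneg fun x _ => mul_nonneg ENNReal.toReal_nonneg (hg x)]
  refine Finset.sum_congr rfl fun x _ => ?_
  rw [ENNReal.ofReal_mul ENNReal.toReal_nonneg, ENNReal.ofReal_toReal (p.apply_ne_top x)]

end Expectation

/-- Only finitely many partitions of the message tuples exist, so replacing answers by the
partitions they induce turns expectations over an arbitrary discrete key into finite sums. -/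
noncomputable instance fintypeSetoid {Ω : Type*} [Fintype Ω] : Fintype (Setoid Ω) :=
  have : Finite (Setoid Ω) := Finite.of_injective (fun r : Setoid Ω => (r : Ω → Ω → Prop))
    fun _ _ h => Setoid.ext fun a b => iff_of_eq (congrFun (congrFun h a) b)
  Fintype.ofFinite _

/-! ### Conditional entropy as a rank. -/

section CondEntropy

variable {Ω : Type*} [Fintype Ω]

theorem isRank_entropy [Nonempty Ω] : IsRank (entropy : Setoid Ω → ℝ) where
  top := by
    have h : (Fintype.card Ω : ℝ) ≠ 0 := by exact_mod_cast Fintype.card_ne_zero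
    simp [entropy, classSize, h]
  anti := entropy_antitone
  sub := entropy_submodular

/-- The entropy of the partition `r` conditional on the partition `g`. -/
noncomputable def condEntropy (g r : Setoid Ω) : ℝ := entropy (g ⊓ r) - entropy g

theorem isRank_condEntropy (g : Setoid Ω) : IsRank (condEntropy g) where
  top := by simp [condEntropy]
  anti r s h := sub_le_sub_right (entropy_antitone (inf_le_inf_left g h)) _
  sub r s t := by
    have h := entropy_submodular r s (g ⊓ t)
    have e : ∀ u : Setoid Ω, u ⊓ (g ⊓ t) = g ⊓ (u ⊓ t) := fun u => by ac_rfl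
    rw [e, e, e] at h
    simp only [condEntropy]
    linarith

end CondEntropy

/-! ### Entropy of the first messages. -/

section Known

variable {K L : ℕ} {X : Type}

/-- The partition of the message tuples according to the first `r` messages. -/
def known (K L : ℕ) (X : Type) (r : ℕ) : Setoid (Fin K → Fin L → X) where
  r w w' := ∀ i : Fin K, (i : ℕ) < r → w i = w' i
  iseqv := ⟨fun _ _ _ => rfl, fun h i hi => (h i hi).symm,
    fun h h' i hi => (h i hi).trans (h' i hi)⟩

theorem known_apply {r : ℕ} {w w' : Fin K → Fin L → X} :
    known K L X r w w' ↔ ∀ i : Fin K, (i : ℕ) < r → w i = w' i := Iff.rfl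

theorem known_succ_le (r : ℕ) : known K L X (r + 1) ≤ known K L X r :=
  fun _ _ h i hi => h i (by omega)

theorem classSize_known [Fintype X] {r : ℕ} (hr : r ≤ K) (w : Fin K → Fin L → X) :
    classSize (known K L X r) w = ((Fintype.card X : ℝ) ^ L) ^ (K - r) := by
  classical
  have h : (Finset.univ.filter fun w' => known K L X r w w') =
      Fintype.piFinset fun i : Fin K => if (i : ℕ) < r then {w i} else Finset.univ := by
    ext w'
    simp only [Finset.mem_filter, Finset.mem_univ, true_and, Fintype.mem_piFinset, known_apply]
    refine forall_congr' fun i => ?_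
    split_ifs with hi <;> simp [hi, eq_comm]
  have h2 : ∀ i : Fin K, (if (i : ℕ) < r then ({w i} : Finset (Fin L → X)) else Finset.univ).card =
      if r ≤ (i : ℕ) then Fintype.card X ^ L else 1 := by
    intro i
    split_ifs with h1 h2 <;> first | omega | simp
  have h3 : (Finset.univ.filter fun i : Fin K => r ≤ (i : ℕ)).card = K - r := card_upper hr
  unfold classSize
  rw [show (Finset.univ.filter fun w' => known K L X r w w').card = (Fintype.card X ^ L) ^ (K - r) by
    rw [h, Fintype.card_piFinset, Finset.prod_congr rfl fun i _ => h2 i, Finset.prod_ite]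
    simp [h3]]
  push_cast
  rfl

theorem entropy_known [Fintype X] [Nonempty X] {r : ℕ} (hr : r ≤ K) :
    entropy (known K L X r) = r * (L * Real.log (Fintype.card X)) := by
  have hX : (Fintype.card (Fin K → Fin L → X) : ℝ) ≠ 0 := by
    exact_mod_cast Fintype.card_ne_zero
  rw [entropy, Finset.sum_congr rfl fun w _ => by rw [classSize_known hr w], Finset.sum_const,
    Finset.card_univ, nsmul_eq_mul, mul_div_cancel_left₀ _ hX]
  simp only [Fintype.card_pi, Finset.prod_const, Finset.card_univ, Fintype.card_fin, Nat.cast_pow,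
    Real.log_pow, Nat.cast_sub hr]
  ring

end Known

/-! ### Entropy inequalities for a PIR code. -/

section Code

variable {N K L : ℕ} {X Y : Type} (c : PIRCode N K L X Y)

/-- The partition of the message tuples induced by the content of a server. -/
def PIRCode.storePart (n : Fin N) : Setoid (Fin K → Fin L → X) := Setoid.ker (c.store n)

/-- The partition of the message tuples induced by the answer of a server to a query. -/
def PIRCode.answerPart (n : Fin N) (q : c.Query n) : Setoid (Fin K → Fin L → X) :=
  Setoid.ker fun w => c.answer n q (c.store n w)

/-- The joint law of the partitions induced by the answers when message `k` is retrieved. -/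
noncomputable def PIRCode.answerLaw (k : Fin K) : PMF (Fin N → Setoid (Fin K → Fin L → X)) :=
  c.key.map fun f n => c.answerPart n (c.query k f n)

theorem PIRCode.mem_support_answerLaw {k : Fin K} {τ : Fin N → Setoid (Fin K → Fin L → X)}
    (hτ : τ ∈ (c.answerLaw k).support) :
    ∃ f ∈ c.key.support, ∀ n, τ n = c.answerPart n (c.query k f n) := by
  obtain ⟨f, hf, rfl⟩ := (PMF.mem_support_map_iff _ _ _).1 hτ
  exact ⟨f, hf, fun _ => rfl⟩

theorem PIRCode.storePart_le {k : Fin K} {τ : Fin N → Setoid (Fin K → Fin L → X)}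
    (hτ : τ ∈ (c.answerLaw k).support) (n : Fin N) : c.storePart n ≤ τ n := by
  obtain ⟨f, -, hf⟩ := c.mem_support_answerLaw hτ
  rw [hf]
  intro w w' (h : c.store n w = c.store n w')
  change c.answer n _ (c.store n w) = c.answer n _ (c.store n w')
  rw [h]

theorem PIRCode.eq_of_answers {k : Fin K} {τ : Fin N → Setoid (Fin K → Fin L → X)}
    (hτ : τ ∈ (c.answerLaw k).support) {w w' : Fin K → Fin L → X} (h : ∀ n, τ n w w') :
    w k = w' k := by
  obtain ⟨f, hf, hτf⟩ := c.mem_support_answerLaw hτ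
  rw [← c.decode_eq k f hf w, ← c.decode_eq k f hf w']
  congr 1
  funext n
  have := h n
  rw [hτf n] at this
  exact this

variable [Fintype X]

/-- Privacy: a function of the answer of a single server has the same expectation for every
retrieved message. -/
theorem PIRCode.expect_answer_eq (k k' : Fin K) (n : Fin N)
    (g : Setoid (Fin K → Fin L → X) → ℝ) :
    expect (c.answerLaw k) (fun τ => g (τ n)) = expect (c.answerLaw k') (fun τ => g (τ n)) := by
  have h : ∀ k, (c.answerLaw k).map (fun τ => τ n) =
      (c.key.map fun f => c.query k f n).map (c.answerPart n) := by
    intro k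
    rw [PIRCode.answerLaw, PMF.map_comp, PMF.map_comp]
    rfl
  have h2 := fun k => expect_map (c.answerLaw k) (fun τ => τ n) g
  have h3 := h2 k
  rw [h, c.privacy n k k', ← h, h2] at h3
  exact h3.symm

/-- Each term contains the answer of a single server, so privacy of the marginal queries is enough.
This fails for `mixedAvg`, which depends on the joint law. -/
theorem PIRCode.expect_condAvg_eq (φ : Setoid (Fin K → Fin L → X) → ℝ) (k k' : Fin K) (i : ℕ) :
    expect (c.answerLaw k) (fun τ => condAvg φ c.storePart τ i) =
      expect (c.answerLaw k') (fun τ => condAvg φ c.storePart τ i) := by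
  unfold condAvg
  split_ifs with hi
  · rw [expect_permAvg, expect_permAvg]
    congr 1
    funext π
    exact c.expect_answer_eq k k' _ fun s =>
      φ (s ⊓ (lower N i).inf (c.storePart ∘ π)) - φ ((lower N i).inf (c.storePart ∘ π))
  · rw [expect_const, expect_const]

/-- The average entropy of the answers of `m` servers and of the contents of the others, when the
message `r` is retrieved and the messages before it are known. -/
noncomputable def PIRCode.avgEntropy (r : Fin K) (m : ℕ) : ℝ :=
  expect (c.answerLaw r) fun τ =>
    mixedAvg (condEntropy (known K L X r)) c.storePart τ (N - m)

/-- The retrieved message contributes its full entropy. -/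
theorem PIRCode.mixedAvg_known [Nonempty X] {r : Fin K} {τ : Fin N → Setoid (Fin K → Fin L → X)}
    (hτ : τ ∈ (c.answerLaw r).support) (k : ℕ) :
    mixedAvg (condEntropy (known K L X r)) c.storePart τ k =
      L * Real.log (Fintype.card X) +
        mixedAvg (condEntropy (known K L X (r + 1))) c.storePart τ k := by
  rw [mixedAvg, mixedAvg, ← permAvg_const (N := N) (L * Real.log (Fintype.card X)), ← permAvg_add]
  congr 1
  funext π
  set x := (upper N k).inf (τ ∘ π) ⊓ (lower N k).inf (c.storePart ∘ π) with hx
  -- Every answer is either present in `x` or determined by a content present in `x`.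
  have hxτ : ∀ n, x ≤ τ n := by
    intro n
    have hn : n = π (π.symm n) := (π.apply_symm_apply n).symm
    rcases le_or_gt k (π.symm n : ℕ) with h | h
    · have := Finset.inf_le (f := τ ∘ π) (mem_upper.2 h)
      rw [Function.comp_apply, ← hn] at this
      exact inf_le_left.trans this
    · have := Finset.inf_le (f := c.storePart ∘ π) (mem_lower.2 h)
      rw [Function.comp_apply, ← hn] at this
      exact inf_le_right.trans (this.trans (c.storePart_le hτ n))
  have e : known K L X r ⊓ x = known K L X (r + 1) ⊓ x := by
    apply le_antisymm
    · refine le_inf ?_ inf_le_right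
      intro w w' h i hi
      rcases Nat.lt_succ_iff_lt_or_eq.1 hi with hi | hi
      · exact h.1 i hi
      · rw [Fin.ext hi]
        exact c.eq_of_answers hτ fun n => hxτ n h.2
    · exact inf_le_inf_right _ (known_succ_le r)
  rw [condEntropy, condEntropy, e, entropy_known r.2.le, entropy_known r.2]
  push_cast
  ring

theorem PIRCode.le_avgEntropy_last [Nonempty X] (r : Fin K) (m : ℕ) :
    L * Real.log (Fintype.card X) ≤ c.avgEntropy r m := by
  rw [← expect_const (c.answerLaw r) (L * Real.log (Fintype.card X))]
  refine expect_mono fun τ hτ => ?_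
  rw [c.mixedAvg_known hτ]
  have : 0 ≤ mixedAvg (condEntropy (known K L X (r + 1))) c.storePart τ (N - m) := by
    rw [← permAvg_const (N := N) 0]
    exact permAvg_mono fun π => (isRank_condEntropy _).nonneg _
  linarith

/-- The average conditional entropy of an answer given the contents of `i` other servers, when the
messages up to `r` are known. -/
noncomputable def PIRCode.avgAnswer (r : Fin K) (i : ℕ) : ℝ :=
  expect (c.answerLaw r) fun τ =>
    condAvg (condEntropy (known K L X r)) c.storePart τ i

/-- The average entropy of the contents of `i` servers given the messages before `r`. -/
noncomputable def PIRCode.avgStore (r i : ℕ) : ℝ :=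
  lowerAvg (condEntropy (known K L X r)) c.storePart i

/-- The passage from message `r` to `r + 1`: decode, split the rest into single-answer terms by
`le_mixedAvg`, and only then change the query by privacy. -/
theorem PIRCode.le_avgEntropy [Nonempty X] {r r' : Fin K} (hr : (r' : ℕ) = r + 1) {m : ℕ}
    (hm : m ≤ N) :
    L * Real.log (Fintype.card X) +
      (c.avgStore r' (N - m) + ∑ j ∈ Finset.Icc 1 m, c.avgAnswer r' (N - j)) ≤
        c.avgEntropy r m := by
  have e : ∀ j, c.avgAnswer r' (N - j) = expect (c.answerLaw r) fun τ =>
      condAvg (condEntropy (known K L X r')) c.storePart τ (N - j) :=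
    fun j => c.expect_condAvg_eq _ r' r (N - j)
  rw [Finset.sum_congr rfl fun j _ => e j, ← expect_sum, ← expect_const (c.answerLaw r)
    (L * Real.log (Fintype.card X)), ← expect_const (c.answerLaw r) (c.avgStore r' (N - m)),
    ← expect_add, ← expect_add]
  refine expect_mono fun τ hτ => ?_
  rw [c.mixedAvg_known hτ, ← hr]
  exact add_le_add_right (le_mixedAvg (isRank_condEntropy _) (c.storePart_le hτ) hm) _

theorem PIRCode.avgEntropy_le (r : Fin K) {j : ℕ} (hj : j ≤ N) :
    c.avgEntropy r j ≤ c.avgStore r (N - j) + j * c.avgAnswer r (N - j) := by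
  rw [PIRCode.avgAnswer, ← expect_const_mul, ← expect_const (c.answerLaw r)
    (c.avgStore r (N - j)), ← expect_add]
  exact expect_mono fun τ _ => mixedAvg_le (isRank_condEntropy _) hj

theorem PIRCode.avgAnswer_nonneg (r : Fin K) (i : ℕ) : 0 ≤ c.avgAnswer r i := by
  rw [← expect_const (c.answerLaw r) 0]
  exact expect_mono fun τ _ => condAvg_nonneg (isRank_condEntropy _) i

theorem PIRCode.avgStore_add_avgAnswer_le (r : Fin K) {i : ℕ} (hi : i < N) :
    c.avgStore r i + c.avgAnswer r i ≤ c.avgStore r (i + 1) := by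
  have h : c.avgAnswer r i ≤ condAvg (condEntropy (known K L X r)) c.storePart c.storePart i := by
    rw [← expect_const (c.answerLaw r)
      (condAvg (condEntropy (known K L X r)) c.storePart c.storePart i)]
    exact expect_mono fun τ hτ =>
      condAvg_mono_right (isRank_condEntropy _) (c.storePart_le hτ) i
  have h2 := lowerAvg_succ (φ := condEntropy (known K L X r)) (σ := c.storePart) hi
  unfold PIRCode.avgStore
  linarith

/-- Combines `le_mul_lowerAvg_add_condAvg` with Han's inequality for the answers, which compares `i
+ 1` of them with all `N`. -/
theorem PIRCode.le_mul_avgStore_add_avgAnswer (r : Fin K) {i : ℕ} (hi : i < N) :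
    (i : ℝ) * c.avgStore r (i + 1) + (i + 1) * (c.avgEntropy r N / N) ≤
      (i + 1) * (c.avgStore r i + c.avgAnswer r i) := by
  have hN : (0 : ℝ) < N := by exact_mod_cast (by omega : 0 < N)
  have h1 : expect (c.answerLaw r) (fun τ => i * c.avgStore r (i + 1) +
      (i + 1) / N * mixedAvg (condEntropy (known K L X r)) c.storePart τ (N - N)) ≤
      expect (c.answerLaw r) (fun τ => (i + 1) * (c.avgStore r i +
        condAvg (condEntropy (known K L X r)) c.storePart τ i)) := by
    refine expect_mono fun τ hτ => ?_
    have h2 := le_mul_lowerAvg_add_condAvg (isRank_condEntropy (known K L X r))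
      (c.storePart_le hτ) hi
    have h3 := mul_lowerAvg_le (σ := τ) (isRank_condEntropy (known K L X r))
      (k := i + 1) (l := N) hi le_rfl
    rw [Nat.sub_self, mixedAvg_zero]
    have h4 : ((i : ℝ) + 1) / N * lowerAvg (condEntropy (known K L X r)) τ N ≤
        lowerAvg (condEntropy (known K L X r)) τ (i + 1) := by
      rw [div_mul_eq_mul_div, div_le_iff₀ hN]
      push_cast at h3
      linarith
    unfold PIRCode.avgStore
    linarith
  rw [expect_add, expect_const, expect_const_mul, expect_const_mul, expect_add, expect_const] at h1
  have e : ((i : ℝ) + 1) * (c.avgEntropy r N / N) = (i + 1) / N * c.avgEntropy r N := by ring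
  rw [e]
  exact h1

/-- Only one message is still unknown. -/
theorem PIRCode.avgStore_le_of_last [Nonempty X] {r : ℕ} (hr : r + 1 = K) (i : ℕ) :
    c.avgStore r i ≤ L * Real.log (Fintype.card X) := by
  refine lowerAvg_le (fun x => ?_) i
  have h1 : entropy (known K L X r ⊓ x) ≤ entropy (known K L X K) := by
    refine entropy_antitone fun w w' h => ?_
    have : w = w' := funext fun i => h i i.2
    subst this
    exact Setoid.refl' _ w
  rw [entropy_known le_rfl] at h1
  rw [condEntropy, entropy_known (by omega : r ≤ K)]
  have : (K : ℝ) = r + 1 := by exact_mod_cast hr.symm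
  rw [this] at h1
  linarith

theorem PIRCode.mul_avgStore_le (r : ℕ) {j m : ℕ} (hjm : j ≤ m) (hm : m ≤ N) :
    ((N : ℝ) - m) * c.avgStore r (N - j) ≤ ((N : ℝ) - j) * c.avgStore r (N - m) := by
  have h := mul_lowerAvg_le (σ := c.storePart) (isRank_condEntropy (known K L X r))
    (k := N - m) (l := N - j) (by omega) (by omega)
  rwa [Nat.cast_sub hm, Nat.cast_sub (hjm.trans hm)] at h

end Code

/-! ### Boundary values of the explicit bound. -/

section ExplicitBound

variable {N : ℕ}

theorem explicitB_one {d : ℕ} (hd : 1 ≤ d) : explicitB N d 1 = d := by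
  match d, hd with
  | 1, _ => simp [explicitB]
  | 2, _ => simp [explicitB]
  | d + 3, _ => simp [explicitB]

theorem explicitB_self (hN : 2 ≤ N) {d : ℕ} (hd : 1 ≤ d) : explicitB N d N = N * beta0 N d := by
  have h1 : N ≠ 1 := by omega
  have h2 : (N : ℝ) ≠ 0 := by exact_mod_cast (by omega : N ≠ 0)
  match d, hd with
  | 1, _ => simp [explicitB, beta0, h2]
  | 2, _ => simp [explicitB, h1]
  | d + 3, _ => simp [explicitB, h1]

theorem mul_beta0_succ (hN : 2 ≤ N) (d : ℕ) : (N : ℝ) * beta0 N (d + 1) = 1 + beta0 N d := by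
  have h2 : (N : ℝ) ≠ 0 := by exact_mod_cast (by omega : N ≠ 0)
  induction d with
  | zero => simp [beta0, h2]
  | succ d ih =>
    have e : ∀ d, beta0 N (d + 1) = beta0 N d + 1 / (N : ℝ) ^ (d + 1) := fun d =>
      Finset.sum_Icc_succ_top (by omega) _
    rw [e (d + 1), mul_add, ih, e d]
    field_simp
    ring

end ExplicitBound

/-! ### The induction and the passage to operational costs. -/

section Converse

variable {N K L : ℕ} {X Y : Type} [Fintype X] [Nonempty X]

/-- Induction on the number `d + 1` of messages not yet known, with the code fixed. -/
theorem PIRCode.mul_explicitB_le_avgEntropy (c : PIRCode N K L X Y) (hN : 2 ≤ N) (d : ℕ)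
    (r : Fin K) (hr : (r : ℕ) + (d + 1) = K) {m : ℕ} (hm : 1 ≤ m) (hmN : m ≤ N) :
    L * Real.log (Fintype.card X) * explicitB N (d + 1) m ≤ c.avgEntropy r m := by
  induction d generalizing r m with
  | zero => simpa [explicitB] using c.le_avgEntropy_last r m
  | succ d ih =>
    obtain ⟨r', hr'⟩ : ∃ r' : Fin K, (r' : ℕ) = r + 1 := ⟨⟨r + 1, by omega⟩, rfl⟩
    have ih := fun {m : ℕ} => ih r' (by omega) (m := m)
    refine le_trans ?_ (c.le_avgEntropy hr' hmN)
    set l := L * Real.log (Fintype.card X) with hl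
    have hprev : ∀ j, 1 ≤ j → j ≤ N → l * explicitB N (d + 1) j ≤
        c.avgStore r' (N - j) + j * c.avgAnswer r' (N - j) :=
      fun j h1 h2 => (ih h1 h2).trans (c.avgEntropy_le r' h2)
    rcases hm.eq_or_lt with rfl | hm2
    · have h := hprev 1 le_rfl hmN
      rw [explicitB_one (by omega)] at h ⊢
      push_cast at h ⊢
      simp only [Finset.Icc_self, Finset.sum_singleton]
      linarith
    rcases hmN.eq_or_lt with rfl | hmN
    · have h := hprev m hm le_rfl
      -- When `m = N` no content is left in the condition; the term `j = N` of the sum alone yields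
      -- the recursion `mul_beta0_succ`.
      have h0 : c.avgStore r' (m - m) = 0 := by
        rw [Nat.sub_self]
        exact lowerAvg_zero (isRank_condEntropy _)
      have hm0 : (0 : ℝ) < m := by exact_mod_cast hm
      rw [explicitB_self hN (by omega), h0, zero_add, mul_left_comm] at h
      have h' := le_of_mul_le_mul_left h hm0
      rw [explicitB_self hN (by omega), mul_beta0_succ hN, h0, zero_add, mul_add, mul_one]
      refine add_le_add_right (h'.trans ?_) _
      exact Finset.single_le_sum (f := fun j => c.avgAnswer r' (m - j))
        (fun j _ => c.avgAnswer_nonneg r' _) (Finset.mem_Icc.2 ⟨hm, le_rfl⟩)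
    have hm1 : m ≠ 1 := by omega
    have hmN1 : m ≠ N := by omega
    cases d with
    | zero =>
      rw [show explicitB N (0 + 1 + 1) m = formulaTwo N m (jStarTwo N m) by
        simp [explicitB, hm1, hmN1]]
      have hidx : ∀ j < m, N - j = N - (j + 1) + 1 := fun j hj => by omega
      refine formulaTwo_le hm2 hmN (σ := fun j => c.avgStore r' (N - j))
        (a := fun j => c.avgAnswer r' (N - j))
        (fun j => c.avgStore_le_of_last (by omega) _)
        (fun j h1 h2 => ?_) (fun j hj => ?_) (fun j hj => ?_)
      · simpa [explicitB] using hprev j h1 (h2.trans hmN.le)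
      · rw [hidx j hj]
        exact c.avgStore_add_avgAnswer_le r' (by omega)
      · have h1 := c.le_mul_avgStore_add_avgAnswer r' (i := N - (j + 1)) (by omega)
        -- The answers of all servers determine the last message.
        have h2 : l / N ≤ c.avgEntropy r' N / N := by
          have := c.le_avgEntropy_last r' N
          gcongr
        have h3 : ((N - (j + 1) : ℕ) : ℝ) = N - j - 1 := by
          rw [Nat.cast_sub (by omega)]
          push_cast
          ring
        have hj' : (j : ℝ) + 1 ≤ N := by exact_mod_cast (by omega : j + 1 ≤ N)
        rw [← hidx j hj, h3, sub_add_cancel] at h1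
        have h4 : ((N : ℝ) - j) * (l / N) ≤ (N - j) * (c.avgEntropy r' N / N) :=
          mul_le_mul_of_nonneg_left h2 (by linarith)
        linarith
    | succ d =>
      rw [show explicitB N (d + 1 + 1 + 1) m =
          formulaStep N m (jStar N m) (explicitB N (d + 1 + 1)) by
        simp [explicitB, hm1, hmN1]]
      exact formulaStep_le hm2 hmN (σ := fun j => c.avgStore r' (N - j))
        (a := fun j => c.avgAnswer r' (N - j)) (fun j => c.avgAnswer_nonneg r' _)
        (fun j hj => c.mul_avgStore_le r' hj hmN.le)
        (fun j h1 h2 => hprev j h1 (h2.trans hmN.le))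

theorem PIRCode.sum_entropy_storePart_le (c : PIRCode N K L X Y) (hN : 0 < N) (hL : 1 ≤ L)
    (hX : 2 ≤ Fintype.card X) :
    (∑ n, entropy (c.storePart n)) / N ≤ L * Real.log (Fintype.card X) * c.storageCost := by
  have hlog : 0 < Real.log (Fintype.card X) := Real.log_pos (by exact_mod_cast hX)
  have hN' : (0 : ℝ) < N := by exact_mod_cast hN
  have hL' : (0 : ℝ) < L := by exact_mod_cast hL
  have e : L * Real.log (Fintype.card X) * c.storageCost =
      (∑ n, Real.log (Fintype.card (c.Store n))) / N := by
    simp only [PIRCode.storageCost, Real.logb, ← Finset.sum_div]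
    field_simp
  rw [e]
  gcongr with n
  exact entropy_ker_le_log_card _

/-- For a fixed query the length is fixed, so the answer has at most `|Y| ^ ℓ` values. -/
theorem PIRCode.ofReal_expect_entropy_le [Fintype Y] (c : PIRCode N K L X Y) (k : Fin K)
    (n : Fin N) :
    ENNReal.ofReal (expect (c.answerLaw k) fun τ => entropy (τ n)) ≤
      ENNReal.ofReal (Real.log (Fintype.card Y)) * c.expectedLen k n := by
  have hlen : ∀ f, entropy (c.answerPart n (c.query k f n)) ≤
      Real.log (Fintype.card Y) * c.len n (c.query k f n) := by
    intro f
    refine (entropy_ker_le_log_card _).trans (le_of_eq ?_)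
    rw [Fintype.card_fun, Fintype.card_fin, Nat.cast_pow, Real.log_pow, mul_comm]
  calc _ = ∑ τ, c.answerLaw k τ * ENNReal.ofReal (entropy (τ n)) :=
        ofReal_expect _ fun τ => isRank_entropy.nonneg (τ n)
    _ = ∑' f, c.key f * ENNReal.ofReal (entropy (c.answerPart n (c.query k f n))) :=
        sum_map_mul c.key (fun f n => c.answerPart n (c.query k f n))
          fun τ => ENNReal.ofReal (entropy (τ n))
    _ ≤ ∑' f, ENNReal.ofReal (Real.log (Fintype.card Y)) *
          (c.key f * (c.len n (c.query k f n) : ℝ≥0∞)) := by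
        refine ENNReal.tsum_le_tsum fun f => ?_
        rw [mul_left_comm, ← ENNReal.ofReal_natCast,
          ← ENNReal.ofReal_mul (Real.log_natCast_nonneg _)]
        gcongr
        exact hlen f
    _ = _ := ENNReal.tsum_mul_left

theorem PIRCode.sum_expect_entropy_le [Fintype Y] (c : PIRCode N K L X Y) (hN : 0 < N) (hL : 1 ≤ L)
    (hX : 2 ≤ Fintype.card X) (k : Fin K) {β : ℝ}
    (hβ : ((c.downloadCost k : ℝ≥0∞) : EReal) ≤ ((β : ℝ) : EReal)) :
    (∑ n, expect (c.answerLaw k) fun τ => entropy (τ n)) / N ≤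
      L * Real.log (Fintype.card X) * β := by
  have hlog : 0 < Real.log (Fintype.card X) := Real.log_pos (by exact_mod_cast hX)
  have hN' : (0 : ℝ) < N := by exact_mod_cast hN
  have hL' : (0 : ℝ) < L := by exact_mod_cast hL
  have hβ0 : 0 ≤ β := by
    have := (EReal.coe_ennreal_nonneg (c.downloadCost k)).trans hβ
    exact_mod_cast this
  have hcost : c.downloadCost k ≤ ENNReal.ofReal β := by
    rw [← EReal.coe_ennreal_le_coe_ennreal_iff, EReal.coe_ennreal_ofReal, max_eq_left hβ0]
    exact hβ
  have h : ENNReal.ofReal (∑ n, expect (c.answerLaw k) fun τ => entropy (τ n)) ≤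
      ENNReal.ofReal (N * (L * Real.log (Fintype.card X)) * β) := by
    calc _ ≤ ∑ n, ENNReal.ofReal (expect (c.answerLaw k) fun τ => entropy (τ n)) :=
          Finset.le_sum_of_subadditive _ ENNReal.ofReal_zero.le
            (fun _ _ => ENNReal.ofReal_add_le) _ _
      _ ≤ ∑ n, ENNReal.ofReal (Real.log (Fintype.card Y)) * c.expectedLen k n :=
          Finset.sum_le_sum fun n _ => c.ofReal_expect_entropy_le k n
      _ = ENNReal.ofReal (N * (L * Real.log (Fintype.card X))) * c.downloadCost k := by
          rw [← Finset.mul_sum, PIRCode.downloadCost, ← mul_assoc,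
            ← ENNReal.ofReal_mul (by positivity)]
          congr 2
          rw [Real.logb]
          field_simp
      _ ≤ ENNReal.ofReal (N * (L * Real.log (Fintype.card X))) * ENNReal.ofReal β := by gcongr
      _ = _ := (ENNReal.ofReal_mul (by positivity)).symm
  rw [ENNReal.ofReal_le_ofReal_iff (by positivity)] at h
  rw [div_le_iff₀ hN']
  linarith

/-- Every achievable pair satisfies the explicit bound. -/
theorem explicitB_le_of_achievable {N K m : ℕ} (hK : 1 ≤ K) (hN : 2 ≤ N) (hm : 1 ≤ m) (hmN : m ≤ N)
    {α β : ℝ} (h : Achievable N K α β) :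
    explicitB N K m ≤ ((N : ℝ) - m) * α + m * β := by
  obtain ⟨L, X, Y, _, _, c, hL, hX, hα, hβ⟩ := h
  have : Nonempty X := Fintype.card_pos_iff.1 (by omega)
  obtain ⟨d, rfl⟩ : ∃ d, K = d + 1 := ⟨K - 1, by omega⟩
  have hlog : 0 < Real.log (Fintype.card X) := Real.log_pos (by exact_mod_cast hX)
  have hL' : (0 : ℝ) < L := by exact_mod_cast hL
  have hmN' : (m : ℝ) ≤ N := by exact_mod_cast hmN
  have h1 := c.mul_explicitB_le_avgEntropy hN d 0 (by simp) hm hmN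
  -- Before the first message nothing is known, so the conditioning is trivial.
  have h0 : condEntropy (known (d + 1) L X ((0 : Fin (d + 1)) : ℕ)) = entropy := by
    funext r
    have htop : known (d + 1) L X ((0 : Fin (d + 1)) : ℕ) = ⊤ := by
      ext w w'
      simp [known_apply]
    rw [condEntropy, htop, top_inf_eq, isRank_entropy.top, sub_zero]
  have h2 : c.avgEntropy 0 m ≤
      m * ((∑ n, expect (c.answerLaw 0) fun τ => entropy (τ n)) / N) +
        ((N : ℝ) - m) * ((∑ n, entropy (c.storePart n)) / N) := by
    rw [PIRCode.avgEntropy, h0, ← expect_sum, div_eq_inv_mul _ (N : ℝ), ← expect_const_mul,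
      ← expect_const_mul, ← expect_const (c.answerLaw 0)
        (((N : ℝ) - m) * ((∑ n, entropy (c.storePart n)) / N)), ← expect_add]
    refine expect_mono fun τ _ => ?_
    rw [← div_eq_inv_mul]
    exact mixedAvg_le_sum isRank_entropy hmN
  have h3 := c.sum_entropy_storePart_le (by omega) hL hX
  have h4 := c.sum_expect_entropy_le (by omega) hL hX 0 (hβ 0)
  have h5 : L * Real.log (Fintype.card X) * c.storageCost ≤
      L * Real.log (Fintype.card X) * α := by gcongr
  have h6 : L * Real.log (Fintype.card X) * explicitB N (d + 1) m ≤
      L * Real.log (Fintype.card X) * (((N : ℝ) - m) * α + m * β) := by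
    have h7 := mul_le_mul_of_nonneg_left (h3.trans h5) (sub_nonneg.2 hmN')
    have h8 := mul_le_mul_of_nonneg_left h4 (Nat.cast_nonneg (α := ℝ) m)
    linarith
  exact le_of_mul_le_mul_left h6 (by positivity)

/-- The code in which every server stores and returns all the messages. -/
noncomputable def replicationCode (N K : ℕ) (hN : 0 < N) : PIRCode N K 1 Bool Bool where
  Store _ := Fin K → Fin 1 → Bool
  Key := Unit
  key := PMF.pure ()
  Query _ := Unit
  store _ w := w
  query _ _ _ := ()
  len _ _ := K
  answer _ _ s i := s i 0
  decode k _ a := fun _ => a ⟨0, hN⟩ k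
  decode_eq k _ _ w := by
    funext i
    rw [Subsingleton.elim i 0]
  privacy _ _ _ := rfl

/-- Needed because a lower bound passes to the real `sInf` only for a nonempty set. -/
theorem exists_achievable (N K : ℕ) (hN : 0 < N) : ∃ α β : ℝ, Achievable N K α β := by
  refine ⟨(replicationCode N K hN).storageCost,
    (ENNReal.ofReal (Real.logb (Fintype.card Bool : ℝ) (Fintype.card Bool : ℝ) /
      ((N : ℝ) * ((1 : ℕ) : ℝ))) * ∑ _n : Fin N, (K : ℝ≥0∞)).toReal,
    1, Bool, Bool, inferInstance, inferInstance, replicationCode N K hN, le_rfl, by simp, le_rfl,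
    fun k => ?_⟩
  have hlen : ∀ n, (replicationCode N K hN).expectedLen k n = K := by
    intro n
    change ∑' f, (replicationCode N K hN).key f * (K : ℝ≥0∞) = K
    rw [ENNReal.tsum_mul_right, PMF.tsum_coe, one_mul]
  rw [PIRCode.downloadCost, Finset.sum_congr rfl fun n _ => hlen n, EReal.coe_ennreal_toReal]
  exact ENNReal.mul_ne_top ENNReal.ofReal_ne_top
    (ENNReal.sum_ne_top.2 fun _ _ => ENNReal.natCast_ne_top K)

end Converse

end PIR

theorem theorem2 (N K m : ℕ) (hK : 2 ≤ K) (hN : 2 ≤ N) (hm1 : 1 ≤ m) (hmN : m ≤ N) :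
    PIR.optB N K m ≥ PIR.explicitB N K m := by
  obtain ⟨α, β, h⟩ := PIR.exists_achievable N K (by omega)
  refine le_csInf ⟨_, α, β, h, rfl⟩ ?_
  rintro x ⟨α, β, h, rfl⟩
  exact PIR.explicitB_le_of_achievable (by omega) hN hm1 hmN h
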